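/- **Conventions.** An operator $d$-tuple is $A=(A_1,\dots,A_d)\in B(\mathcal H)^d$ with $\mathcal H$ a nonzero complex Hilbert space; $C^*(A)$ is the unital C*-algebra generated by $A_1,\dots,A_d$. The space $M_n^d$ carries the norm $\|X\|=\max_i\|X_i\|$ (operator norm), and $d_{\mathrm H}$ is the associated Hausdorff distance. For $n\ge 1$ the $n$-th level of the matrix range of $A$ is $$\mathcal W_n(A)=\{(\phi(A_1),\dots,\phi(A_d)) : \phi\colon C^*(A)\to M_n \text{ unital completely positive}\}.$$ The one-sided matrix range distance is $$d_{\mathrm{mr}}(A\to B)=\sup_{n\ge1}\ \sup_{X\in\mathcal W_n(A)}\ \inf_{Y\in\mathcal W_n(B)}\|X-Y\| .$$ Write $A\sim B$ if there is a $*$-isomorphism $C^*(A)\to C^*(B)$ mapping $A_i$ to $B_i$ for all $i$. For real $c>0$ write $A\prec cB$ if there are Hilbert spaces $\mathcal H\subseteq\mathcal K$ and tuples $U\in B(\mathcal H)^d$, $V\in B(\mathcal K)^d$ with $U\sim A$, $V\sim B$ and $U_i=P_{\mathcal H}\,cV_i|_{\mathcal H}$ for all $i$. The dilation constant is $c(A,B)=\inf\{c>0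 : A\prec cB\}\in[0,\infty]$, with $\inf\emptyset=\infty$. **Theorem 2.1.** Let $(\xi^{(N)})_{N\in\mathbb N}$ and $(\eta^{(N)})_{N\in\mathbb N}$ be sequences of operator $d$-tuples (on possibly varying Hilbert spaces), and let $\xi^{(\infty)},\eta^{(\infty)}$ be operator $d$-tuples such that for every $n\ge 1$ $$\lim_{N\to\infty}d_{\mathrm H}\bigl(\mathcal W_n(\xi^{(N)}),\mathcal W_n(\xi^{(\infty)})\bigr)=0,\qquad \lim_{N\to\infty}d_{\mathrm H}\bigl(\mathcal W_n(\eta^{(N)}),\mathcal W_n(\eta^{(\infty)})\bigr)=0 .$$ Then $$d_{\mathrm{mr}}(\xi^{(\infty)}\to\eta^{(\infty)})\le\liminf_{N,M\to\infty}d_{\mathrm{mr}}(\xi^{(N)}\to\eta^{(M)}).$$ If moreover $\xi^{(\infty)}\ne 0$ or $0\in\mathcal W_1(\eta^{(\infty)})$ (the former is automatic for tuples of unitaries with $d\ge1$), then $$c(\xi^{(\infty)},\eta^{(\infty)})\le\liminf_{N,M\to\infty}c(\xi^{(N)},\eta^{(M)}).$$ Here $\liminf_{N,M\to\infty}a_{N,M}=\sup_{L}\inf_{N,M\ge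 L}a_{N,M}$, and the inequalities are in $[0,\infty]$. -/

import Mathlib

open Filter Topology Set
open scoped ENNReal CStarAlgebra ComplexOrder

universe u

noncomputable section

namespace MatrixRange

section Basic

variable {d : ℕ} {H : Type u} [NormedAddCommGroup H] [InnerProductSpace ℂ H] [CompleteSpace H]

/-- `C*(A)`: the unital C*-subalgebra of `B(H)` generated by the operator tuple
`A = (A₁, …, A_d)`. -/
def cstarGen (A : Fin d → (H →L[ℂ] H)) : StarSubalgebra ℂ (H →L[ℂ] H) :=
  (StarAlgebra.adjoin ℂ (Set.range A)).topologicalClosure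

instance isClosed_cstarGen (A : Fin d → (H →L[ℂ] H)) :
    IsClosed (cstarGen A : Set (H →L[ℂ] H)) :=
  StarSubalgebra.isClosed_topologicalClosure _

/-- The `i`-th operator of the tuple, as an element of `C*(A)`. -/
def gen (A : Fin d → (H →L[ℂ] H)) (i : Fin d) : cstarGen A :=
  ⟨A i, StarSubalgebra.le_topologicalClosure _
    (StarAlgebra.subset_adjoin ℂ _ (Set.mem_range_self i))⟩

/-- `C*(A)` carries its order as a C*-algebra: `0 ≤ x` iff `x` is self-adjoint with nonnegative
spectrum. -/
instance instPartialOrderCstarGen (A : Fin d → (H →L[ℂ] H)) : PartialOrder (cstarGen A) :=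
  CStarAlgebra.spectralOrder _

instance instStarOrderedRingCstarGen (A : Fin d → (H →L[ℂ] H)) : StarOrderedRing (cstarGen A) :=
  CStarAlgebra.spectralOrderedRing _

/-- The space `M_n^d` of `d`-tuples of complex `n × n` matrices. The norm on
`CStarMatrix (Fin n) (Fin n) ℂ` is the operator norm (for the Euclidean norm on `ℂⁿ`), and the norm
on the product is `‖X‖ = max_i ‖X_i‖`. -/
abbrev MatTuple (d n : ℕ) : Type := Fin d → CStarMatrix (Fin n) (Fin n) ℂ

/-- The `n`-th level `W_n(A) = {φ(A) : φ ∈ UCP(C*(A), M_n)}` of the matrix range of `A`. -/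
def W (n : ℕ) (A : Fin d → (H →L[ℂ] H)) : Set (MatTuple d n) :=
  {X | ∃ φ : cstarGen A →CP CStarMatrix (Fin n) (Fin n) ℂ, φ 1 = 1 ∧ ∀ i, X i = φ (gen A i)}

end Basic

section Two

variable {d : ℕ} {H K : Type u}
  [NormedAddCommGroup H] [InnerProductSpace ℂ H] [CompleteSpace H]
  [NormedAddCommGroup K] [InnerProductSpace ℂ K] [CompleteSpace K]

/-- The one-sided matrix range distance
`d_mr(A → B) = sup_{n ≥ 1} sup_{X ∈ W_n(A)} inf_{Y ∈ W_n(B)} ‖X - Y‖`, as an element of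
`[0, ∞]`. -/
def dmr (A : Fin d → (H →L[ℂ] H)) (B : Fin d → (K →L[ℂ] K)) : ℝ≥0∞ :=
  ⨆ (n : ℕ) (_ : 1 ≤ n), ⨆ X ∈ W n A, ⨅ Y ∈ W n B, edist X Y

/-- `A ∼ B`: there is a *-isomorphism `C*(A) → C*(B)` that sends `A_i` to `B_i` for all `i`. -/
def StarEquivalent (A : Fin d → (H →L[ℂ] H)) (B : Fin d → (K →L[ℂ] K)) : Prop :=
  ∃ π : cstarGen A ≃⋆ₐ[ℂ] cstarGen B, ∀ i, π (gen A i) = gen B i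

/-- `A ≺ cB`: there are Hilbert spaces `H' ⊆ K'` and tuples `U ∼ A` on `H'` and `V ∼ B` on `K'`
such that `U_i = P_{H'} (c V_i)|_{H'}` for all `i`. The inclusion of `H'` in `K'` is a linear
isometry `ι`, so that the compression of an operator `T` to `H'` is `ι* T ι`. -/
def Dilates (A : Fin d → (H →L[ℂ] H)) (c : ℝ) (B : Fin d → (K →L[ℂ] K)) : Prop :=
  ∃ (H' K' : Type u)
    (_ : NormedAddCommGroup H') (_ : InnerProductSpace ℂ H') (_ : CompleteSpace H')
    (_ : NormedAddCommGroup K') (_ : InnerProductSpace ℂ K') (_ : CompleteSpace K')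
    (ι : H' →ₗᵢ[ℂ] K') (U : Fin d → (H' →L[ℂ] H')) (V : Fin d → (K' →L[ℂ] K')),
    StarEquivalent A U ∧ StarEquivalent B V ∧
      ∀ i, U i = ContinuousLinearMap.adjoint ι.toContinuousLinearMap ∘L
        ((c : ℂ) • V i) ∘L ι.toContinuousLinearMap

/-- The dilation constant `c(A, B) = inf {c > 0 : A ≺ cB}`, as an element of `[0, ∞]`, with
`inf ∅ = ∞`. -/
def dilationConst (A : Fin d → (H →L[ℂ] H)) (B : Fin d → (K →L[ℂ] K)) : ℝ≥0∞ :=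
  ⨅ (c : ℝ) (_ : 0 < c) (_ : Dilates A c B), ENNReal.ofReal c

end Two

end MatrixRange

end

/-!
# Semicontinuity of the matrix range distance and of the dilation constant

The inequality for `d_mr` only concerns the sets `W n`: the distance from a point of
`W n ξlim` to `W n ηlim` differs from the distance of a nearby point of `W n (ξ N)` to
`W n (η M)` by at most the two Hausdorff distances (`dmr_le_liminf`).

For the dilation constant, the relation `A ≺ cB` is translated into matrix ranges.

* If `A ≺ cB` with `c > 0`, then `W n A ⊆ c • W n B` for all `n` (`Dilates.exists_smul_eq`). A
  completely positive map `C*(U) → M_n` has to be extended to `B(H')` before it can be composed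
  with the compression of `B(K')` to `H'`. A map into `M_n` is the same thing as a functional on
  `n × n` matrices, so that this is an application of the Riesz extension theorem for positive
  functionals (`CPForm.exists_total_extension`, `CPForm.exists_compression_extension`).
* Conversely, if every `W n A` with `n ≥ 1` is contained in the closure of `c • W n B`, then
  `A ≺ cB` (`dilates_of_forall_mem_closure`). The compressions of `A` to finite-dimensional
  subspaces lie in the sets `W n A`, hence are approximately of the form `c φ(B)` with unital
  completely positive `φ`; an ultrafilter limit of these `φ` is a unital completely positive map
  `C*(B) → B(H)` with `c B_i ↦ A_i`. Stinespring's construction (`CPForm.exists_stinespring`),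
  applied to the direct sum of this map with the identity representation of `C*(B)`, yields a
  dilation on which `C*(B)` acts faithfully (`dilates_of_cpForm`).

If `liminf c(ξ N, η M) < R`, there are `N_k, M_k → ∞` and `c_k ∈ (0, R)` with
`ξ N_k ≺ c_k (η M_k)`, and after passing to a subsequence `c_k → c₀`. A point of `W n ξlim` is then
a limit of points `c_k Y_k` with `Y_k ∈ W n ηlim`. If `c₀ > 0` this gives `ξlim ≺ c₀ ηlim`. If
`c₀ = 0`, boundedness of `W n ηlim` forces `W n ξlim = {0}` and so `ξlim = 0`; in this case
`0 ∈ W 1 ηlim` by hypothesis, hence `0 ∈ W n ηlim` for all `n`, and `ξlim ≺ R ηlim`.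

Completely positive maps with values in the operators on `E` are handled throughout as families of
sesquilinear forms on `E` (`CPForm`), so that limits, compressions and direct sums are formed
pointwise; `mem_W_iff` describes `W n A` in these terms.
-/

namespace MatrixRange

/-! ### Positivity of matrices over an operator algebra -/

section VectorCriterion

lemma exists_eq_star_mul_self_of_nonneg {𝒩 : Type*} [CStarAlgebra 𝒩] [PartialOrder 𝒩]
    [StarOrderedRing 𝒩] {N : 𝒩} (hN : 0 ≤ N) : ∃ T : 𝒩, N = star T * T :=
  CStarAlgebra.nonneg_iff_eq_star_mul_self.mp hN

/-- For `n = N⁻` the conjugate `n* N n = -(N⁻)³` is negative. Hence `0 ≤ N`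
follows from any notion of positivity that is stable under conjugation and under which `-(T* T)` is
positive only for `T = 0`. -/
lemma exists_conjugate_eq_neg_star_mul_self {𝒩 : Type*} [CStarAlgebra 𝒩] [PartialOrder 𝒩]
    [StarOrderedRing 𝒩] {N : 𝒩} (hN : IsSelfAdjoint N) :
    ∃ n T : 𝒩, star n * (N * n) = -(star T * T) ∧ (T = 0 → 0 ≤ N) := by
  have hneg : 0 ≤ N⁻ := CFC.negPart_nonneg N
  have hsa : star N⁻ = N⁻ := hneg.isSelfAdjoint
  have hcube : 0 ≤ N⁻ * N⁻ * N⁻ := by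
    simpa [hsa] using star_left_conjugate_nonneg hneg N⁻
  have hNN : N * N⁻ = - (N⁻ * N⁻) := by
    have h : (N⁺ - N⁻) * N⁻ = - (N⁻ * N⁻) := by
      rw [sub_mul, CFC.posPart_mul_negPart, zero_sub]
    rwa [CFC.posPart_sub_negPart N] at h
  obtain ⟨T, hT⟩ := CStarAlgebra.nonneg_iff_eq_star_mul_self.mp hcube
  refine ⟨N⁻, T, by rw [hsa, hNN, mul_neg, ← mul_assoc, hT], fun hT0 => ?_⟩
  rw [hT0, mul_zero] at hT
  have h2 : N⁻ * N⁻ = 0 := by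
    rw [← CStarRing.star_mul_self_eq_zero_iff, star_mul, hsa, ← mul_assoc, hT, zero_mul]
  have h3 : N⁻ = 0 := by
    rw [← CStarRing.star_mul_self_eq_zero_iff, hsa, h2]
  rw [← CFC.posPart_sub_negPart N, h3, sub_zero]
  exact CFC.posPart_nonneg N

variable {S H : Type*} [CStarAlgebra S]
  [NormedAddCommGroup H] [InnerProductSpace ℂ H] [CompleteSpace H]

lemma inner_map_map (ρ : S →⋆ₐ[ℂ] (H →L[ℂ] H)) (a b : S) (x y : H) :
    inner ℂ (ρ a x) (ρ b y) = inner ℂ x (ρ (star a * b) y) := by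
  rw [map_mul, map_star, ContinuousLinearMap.star_eq_adjoint]
  exact (ContinuousLinearMap.adjoint_inner_right (ρ a) x (ρ b y)).symm

lemma sum_inner_star_mul {k : ℕ} (ρ : S →⋆ₐ[ℂ] (H →L[ℂ] H))
    (T N : CStarMatrix (Fin k) (Fin k) S) (x y : Fin k → H) :
    ∑ i, ∑ j, inner ℂ (x i) (ρ ((star T * N) i j) (y j)) =
      ∑ i, inner ℂ (∑ j, ρ (T i j) (x j)) (∑ j, ρ (N i j) (y j)) := by
  simp only [CStarMatrix.mul_apply, CStarMatrix.star_apply, map_sum, sum_apply, inner_sum,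
    sum_inner, inner_map_map]
  calc _ = ∑ i, ∑ l, ∑ j, inner ℂ (x i) (ρ (star (T l i) * N l j) (y j)) :=
        Finset.sum_congr rfl fun i _ => Finset.sum_comm
    _ = ∑ l, ∑ i, ∑ j, inner ℂ (x i) (ρ (star (T l i) * N l j) (y j)) := Finset.sum_comm
    _ = _ := Finset.sum_congr rfl fun i _ => Finset.sum_comm

/-- Through a faithful representation `ρ` of `S` on `H`, positivity of a self-adjoint matrix over
`S` can be tested on the vectors of `Hᵏ`. -/
lemma nonneg_of_forall_sum_inner_nonneg [PartialOrder S] [StarOrderedRing S] {k : ℕ}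
    (ρ : S →⋆ₐ[ℂ] (H →L[ℂ] H))
    (hρ : Function.Injective ρ) (N : CStarMatrix (Fin k) (Fin k) S) (hN : IsSelfAdjoint N)
    (h : ∀ x : Fin k → H, 0 ≤ (∑ i, ∑ j, inner ℂ (x i) (ρ (N i j) (x j))).re) : 0 ≤ N := by
  obtain ⟨n, T, key, hT⟩ := exists_conjugate_eq_neg_star_mul_self hN
  refine hT ?_
  have h0 : ∀ x : Fin k → H, ∀ i, ∑ j, ρ (T i j) (x j) = 0 := by
    intro x
    have h1 := h (fun i => ∑ j, ρ (n i j) (x j))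
    have h2 : ∑ i, ∑ j, inner ℂ (x i) (ρ ((star n * (N * n)) i j) (x j)) =
        - ∑ i, inner ℂ (∑ j, ρ (T i j) (x j)) (∑ j, ρ (T i j) (x j)) := by
      rw [key, ← sum_inner_star_mul]
      simp [Finset.sum_neg_distrib]
    rw [sum_inner_star_mul] at h2
    have h3 : ∑ i, ∑ j, inner ℂ (∑ l, ρ (n i l) (x l)) (ρ (N i j) (∑ l, ρ (n j l) (x l)))
        = ∑ i, inner ℂ (∑ j, ρ (n i j) (x j)) (∑ j, ρ ((N * n) i j) (x j)) := by
      refine Finset.sum_congr rfl fun i _ => ?_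
      rw [← inner_sum]
      congr 1
      simp only [CStarMatrix.mul_apply, map_sum, map_mul, sum_apply]
      rw [Finset.sum_comm]
      rfl
    rw [h3, h2] at h1
    have h4 : ∑ i, ‖∑ j, ρ (T i j) (x j)‖ ^ 2 ≤ 0 := by
      have : (∑ i, inner ℂ (∑ j, ρ (T i j) (x j)) (∑ j, ρ (T i j) (x j))).re
          = ∑ i, ‖∑ j, ρ (T i j) (x j)‖ ^ 2 := by
        rw [Complex.re_sum]
        exact Finset.sum_congr rfl fun i _ => inner_self_eq_norm_sq (𝕜 := ℂ) _
      rw [Complex.neg_re, this] at h1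
      linarith
    intro i
    have h5 := (Finset.sum_eq_zero_iff_of_nonneg (fun i _ => by positivity)).mp
      (le_antisymm h4 (Finset.sum_nonneg fun i _ => by positivity)) i (Finset.mem_univ i)
    simpa using h5
  ext i j
  apply hρ
  ext v
  -- the vector with the single nonzero entry `v` isolates `ρ (T i j) v`
  have := h0 (Pi.single j v) i
  rw [Finset.sum_eq_single j] at this
  · simpa using this
  · intro l _ hl
    simp [hl]
  · simp

end VectorCriterion

/-! ### Completely positive maps as families of sesquilinear forms -/

/-- A completely positive map from `𝒜` to the operators on `E`, given by the forms
`(x, y) ↦ ⟪x, φ(a) y⟫`, which are conjugate-linear in `x` and linear in `y`. Complete positivity is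
the positivity of the kernel `((a, x), (b, y)) ↦ ⟪x, φ(a* b) y⟫`. The space `E` carries no norm, and
the map need not be unital. Conjugate-linearity in `x` follows from `conj_symm`, which also makes
the sum in `pos` real. -/
structure CPForm (𝒜 E : Type*) [CStarAlgebra 𝒜] [AddCommGroup E] [Module ℂ E] where
  toFun : 𝒜 → E → E → ℂ
  add_alg : ∀ a b x y, toFun (a + b) x y = toFun a x y + toFun b x y
  smul_alg : ∀ (c : ℂ) a x y, toFun (c • a) x y = c * toFun a x y
  add_right : ∀ a x y z, toFun a x (y + z) = toFun a x y + toFun a x z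
  smul_right : ∀ a x (c : ℂ) y, toFun a x (c • y) = c * toFun a x y
  conj_symm : ∀ a x y, star (toFun a x y) = toFun (star a) y x
  pos : ∀ (m : ℕ) (a : Fin m → 𝒜) (x : Fin m → E),
    0 ≤ (∑ i, ∑ j, toFun (star (a i) * a j) (x i) (x j)).re

namespace CPForm

section API

variable {𝒜 E : Type*} [CStarAlgebra 𝒜] [AddCommGroup E] [Module ℂ E]

instance : CoeFun (CPForm 𝒜 E) (fun _ => 𝒜 → E → E → ℂ) := ⟨toFun⟩

variable (s : CPForm 𝒜 E)

/-- The linear functional `a ↦ s a x y` on the algebra. -/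
def algLin (x y : E) : 𝒜 →ₗ[ℂ] ℂ where
  toFun a := s a x y
  map_add' a b := s.add_alg a b x y
  map_smul' c a := s.smul_alg c a x y

/-- The linear functional `y ↦ s a x y`. -/
def rightLin (a : 𝒜) (x : E) : E →ₗ[ℂ] ℂ where
  toFun y := s a x y
  map_add' y z := s.add_right a x y z
  map_smul' c y := s.smul_right a x c y

lemma map_sum_alg {ι : Type*} (t : Finset ι) (a : ι → 𝒜) (x y : E) :
    s (∑ i ∈ t, a i) x y = ∑ i ∈ t, s (a i) x y := map_sum (s.algLin x y) a t

lemma map_sum_right {ι : Type*} (t : Finset ι) (a : 𝒜) (x : E) (y : ι → E) :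
    s a x (∑ i ∈ t, y i) = ∑ i ∈ t, s a x (y i) := map_sum (s.rightLin a x) y t

lemma map_zero_right (a : 𝒜) (x : E) : s a x 0 = 0 := map_zero (s.rightLin a x)

lemma swap (a : 𝒜) (x y : E) : s a x y = star (s (star a) y x) := by
  rw [s.conj_symm, star_star]

lemma add_left (a : 𝒜) (x y z : E) : s a (x + y) z = s a x z + s a y z := by
  rw [s.swap, s.add_right, star_add, ← s.swap, ← s.swap]

lemma smul_left (a : 𝒜) (c : ℂ) (x y : E) : s a (c • x) y = star c * s a x y := by
  rw [s.swap, s.smul_right, star_mul', ← s.swap]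

lemma map_zero_left (a : 𝒜) (x : E) : s a 0 x = 0 := by
  rw [s.swap, s.map_zero_right, star_zero]

lemma map_sum_left {ι : Type*} (t : Finset ι) (a : 𝒜) (x : ι → E) (y : E) :
    s a (∑ i ∈ t, x i) y = ∑ i ∈ t, s a (x i) y := by
  rw [s.swap, s.map_sum_right, star_sum]
  exact Finset.sum_congr rfl fun i _ => (s.swap _ _ _).symm

lemma pos_self (a : 𝒜) (x : E) : 0 ≤ (s (star a * a) x x).re := by
  simpa using s.pos 1 (fun _ => a) (fun _ => x)

/-- The forms of a `*`-representation. -/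
noncomputable def ofRep {K : Type*} [NormedAddCommGroup K] [InnerProductSpace ℂ K]
    [CompleteSpace K] (ρ : 𝒜 →⋆ₐ[ℂ] (K →L[ℂ] K)) : CPForm 𝒜 K where
  toFun a x y := inner ℂ x (ρ a y)
  add_alg a b x y := by rw [map_add, add_apply, inner_add_right]
  smul_alg a b x y := by rw [map_smul, smul_apply, inner_smul_right]
  add_right a x y z := by rw [map_add, inner_add_right]
  smul_right a x c y := by rw [map_smul, inner_smul_right]
  conj_symm a x y := by
    rw [map_star, ContinuousLinearMap.star_eq_adjoint, ContinuousLinearMap.adjoint_inner_right]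
    exact inner_conj_symm _ _
  pos m a x := by
    have h' : ∑ i, ∑ j, inner ℂ (x i) (ρ (star (a i) * a j) (x j)) =
        inner ℂ (∑ i, ρ (a i) (x i)) (∑ i, ρ (a i) (x i)) := by
      rw [sum_inner]
      refine Finset.sum_congr rfl fun i _ => ?_
      rw [inner_sum]
      exact Finset.sum_congr rfl fun j _ => (inner_map_map ρ (a i) (a j) _ _).symm
    rw [h']
    exact inner_self_nonneg (𝕜 := ℂ)

end API

end CPForm

/-! ### Completely positive maps into matrices and matrix ranges -/

section Matrices

/-- The action of `M_n` on Euclidean space. -/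
noncomputable def matRep (n : ℕ) : CStarMatrix (Fin n) (Fin n) ℂ →⋆ₐ[ℂ]
    (EuclideanSpace ℂ (Fin n) →L[ℂ] EuclideanSpace ℂ (Fin n)) :=
  ((CStarMatrix.ofMatrixStarAlgEquiv.symm.trans (Matrix.toEuclideanCLM (n := Fin n) (𝕜 := ℂ))) :
    CStarMatrix (Fin n) (Fin n) ℂ ≃⋆ₐ[ℂ] _)

lemma matRep_injective (n : ℕ) : Function.Injective (matRep n) :=
  (CStarMatrix.ofMatrixStarAlgEquiv.symm.trans
    (Matrix.toEuclideanCLM (n := Fin n) (𝕜 := ℂ))).injective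

lemma matRep_apply {n : ℕ} (M : CStarMatrix (Fin n) (Fin n) ℂ) (q : EuclideanSpace ℂ (Fin n))
    (i : Fin n) : matRep n M q i = ∑ j, M i j * q j := rfl

lemma inner_matRep {n : ℕ} (M : CStarMatrix (Fin n) (Fin n) ℂ) (p q : EuclideanSpace ℂ (Fin n)) :
    inner ℂ p (matRep n M q) = ∑ i, ∑ j, star (p i) * M i j * q j := by
  simp only [PiLp.inner_apply, matRep_apply, RCLike.inner_apply, Finset.sum_mul]
  refine Finset.sum_congr rfl fun i _ => Finset.sum_congr rfl fun j _ => ?_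
  simp; ring

lemma inner_matRep_single {n : ℕ} (M : CStarMatrix (Fin n) (Fin n) ℂ) (i j : Fin n) :
    inner ℂ (EuclideanSpace.single i (1 : ℂ)) (matRep n M (EuclideanSpace.single j 1)) = M i j := by
  simp [EuclideanSpace.inner_single_left, matRep_apply]

variable {𝒜 : Type*} [CStarAlgebra 𝒜]

/-- A matrix `T* T` over `𝒜` is the sum over `l` of the matrices with entries `(T l i)* (T l j)`,
on which `CPForm.pos` applies. -/
lemma CPForm.nonneg_of_cstarMatrix {E : Type*} [PartialOrder 𝒜] [StarOrderedRing 𝒜]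
    [AddCommGroup E] [Module ℂ E] (s : CPForm 𝒜 E) {k : ℕ}
    {N : CStarMatrix (Fin k) (Fin k) 𝒜} (hN : 0 ≤ N) (x : Fin k → E) :
    0 ≤ (∑ i, ∑ j, s (N i j) (x i) (x j)).re := by
  obtain ⟨T, rfl⟩ := exists_eq_star_mul_self_of_nonneg hN
  simp only [CStarMatrix.mul_apply, CStarMatrix.star_apply, s.map_sum_alg]
  have : ∑ i, ∑ j, ∑ l, s (star (T l i) * T l j) (x i) (x j) =
      ∑ l, ∑ i, ∑ j, s (star (T l i) * T l j) (x i) (x j) := by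
    rw [Finset.sum_comm (s := Finset.univ (α := Fin k)) (t := Finset.univ (α := Fin k))
      (f := fun l i => ∑ j, s (star (T l i) * T l j) (x i) (x j))]
    exact Finset.sum_congr rfl fun i _ => Finset.sum_comm
  rw [this, Complex.re_sum]
  exact Finset.sum_nonneg fun l _ => s.pos k (T l) x

/-- The forms `(p, q) ↦ ⟪p, φ(a) q⟫` of a completely positive map `φ : 𝒜 → M_n`. -/
noncomputable def CPForm.ofCP [PartialOrder 𝒜] [StarOrderedRing 𝒜] {n : ℕ}
    (φ : 𝒜 →CP CStarMatrix (Fin n) (Fin n) ℂ) :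
    CPForm 𝒜 (EuclideanSpace ℂ (Fin n)) where
  toFun a p q := inner ℂ p (matRep n (φ a) q)
  add_alg a b x y := by rw [map_add, map_add]; exact inner_add_right _ _ _
  smul_alg c a x y := by rw [map_smul, map_smul]; exact inner_smul_right _ _ _
  add_right a x y z := by rw [map_add, inner_add_right]
  smul_right a x c y := by rw [map_smul, inner_smul_right]
  conj_symm a x y := by
    have h : φ (star a) = star (φ a) := map_star φ a
    rw [h, map_star, ContinuousLinearMap.star_eq_adjoint]
    exact (inner_conj_symm _ _).trans (ContinuousLinearMap.adjoint_inner_right _ _ _).symm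
  pos m a x := by
    -- `(a i)* (a j)` is the `(i, j)` entry of `R* R`, where `a` is the only nonzero row of `R`
    let R : CStarMatrix (Fin m) (Fin m) 𝒜 :=
      CStarMatrix.ofMatrix fun l j => if (l : ℕ) = 0 then a j else 0
    have hRa : ∀ l j, R l j = if (l : ℕ) = 0 then a j else 0 := fun _ _ => rfl
    have hR : ∀ i j, (star R * R) i j = star (a i) * a j := by
      intro i j
      rw [CStarMatrix.mul_apply, Finset.sum_eq_single ⟨0, i.pos⟩]
      · simp [hRa, CStarMatrix.star_apply]
      · intro l _ hl
        have : (l : ℕ) ≠ 0 := fun h => hl (Fin.ext h)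
        simp [hRa, CStarMatrix.star_apply, this]
      · simp
    obtain ⟨T, hT⟩ := exists_eq_star_mul_self_of_nonneg
      (φ.map_cstarMatrix_nonneg _ (star_mul_self_nonneg R))
    have h2 : ∀ i j, φ (star (a i) * a j) = (star T * T) i j := by
      intro i j
      rw [← hT, CStarMatrix.map_apply, hR]
    simp only [h2, sum_inner_star_mul, Complex.re_sum]
    exact Finset.sum_nonneg fun i _ => inner_self_nonneg (𝕜 := ℂ)

/-- The matrix of the form `s a` in the standard basis. -/
noncomputable def CPForm.toMatrix {n : ℕ} (s : CPForm 𝒜 (EuclideanSpace ℂ (Fin n))) (a : 𝒜) :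
    CStarMatrix (Fin n) (Fin n) ℂ :=
  CStarMatrix.ofMatrix fun i j => s a (EuclideanSpace.single i 1) (EuclideanSpace.single j 1)

lemma euclidean_eq_sum {n : ℕ} (p : EuclideanSpace ℂ (Fin n)) :
    p = ∑ i, p i • EuclideanSpace.single i (1 : ℂ) := by
  ext k
  simp [Finset.sum_apply, Pi.single_apply]

lemma CPForm.inner_toMatrix {n : ℕ} (s : CPForm 𝒜 (EuclideanSpace ℂ (Fin n))) (a : 𝒜)
    (p q : EuclideanSpace ℂ (Fin n)) : inner ℂ p (matRep n (s.toMatrix a) q) = s a p q := by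
  conv_rhs => rw [euclidean_eq_sum p, euclidean_eq_sum q]
  rw [inner_matRep, s.map_sum_left]
  refine Finset.sum_congr rfl fun i _ => ?_
  rw [s.map_sum_right]
  refine Finset.sum_congr rfl fun j _ => ?_
  rw [s.smul_left, s.smul_right]
  change star (p i) * s a _ _ * q j = star (p i) * (q j * s a _ _)
  ring

/-- The completely positive map `𝒜 → M_n` with given forms on `ℂⁿ`. -/
noncomputable def CPForm.toCP [PartialOrder 𝒜] [StarOrderedRing 𝒜] {n : ℕ}
    (s : CPForm 𝒜 (EuclideanSpace ℂ (Fin n))) :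
    𝒜 →CP CStarMatrix (Fin n) (Fin n) ℂ where
  toFun a := s.toMatrix a
  map_add' a b := by ext i j; exact s.add_alg _ _ _ _
  map_smul' c a := by ext i j; exact s.smul_alg _ _ _ _
  map_cstarMatrix_nonneg' k M hM := by
    refine nonneg_of_forall_sum_inner_nonneg (matRep n) (matRep_injective n) _ ?_ fun x => ?_
    · refine CStarMatrix.ext fun i j => ?_
      have hMs : star (M j i) = M i j := by
        rw [← CStarMatrix.star_apply, hM.isSelfAdjoint]
      simp only [CStarMatrix.star_apply, CStarMatrix.map_apply]
      refine CStarMatrix.ext fun k l => ?_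
      change star (s (M j i) _ _) = s (M i j) _ _
      rw [s.conj_symm, hMs]
    · simp only [CStarMatrix.map_apply]
      simpa [CPForm.inner_toMatrix] using s.nonneg_of_cstarMatrix hM x

end Matrices

section W
variable {d : ℕ} {H : Type u} [NormedAddCommGroup H] [InnerProductSpace ℂ H] [CompleteSpace H]

/-- The matrix range in terms of forms on `ℂⁿ`. -/
lemma mem_W_iff {n : ℕ} {A : Fin d → (H →L[ℂ] H)} {X : MatTuple d n} :
    X ∈ W n A ↔ ∃ s : CPForm (cstarGen A) (EuclideanSpace ℂ (Fin n)),
      (∀ p q, s 1 p q = inner ℂ p q) ∧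
      ∀ i p q, s (gen A i) p q = inner ℂ p (matRep n (X i) q) := by
  constructor
  · rintro ⟨φ, h1, h2⟩
    refine ⟨CPForm.ofCP φ, fun p q => ?_, fun i p q => ?_⟩
    · simp [CPForm.ofCP, h1]
    · simp [CPForm.ofCP, h2]
  · rintro ⟨s, h1, h2⟩
    refine ⟨s.toCP, ?_, fun i => ?_⟩
    · apply matRep_injective n
      ext1 q
      refine ext_inner_left ℂ fun p => ?_
      rw [show s.toCP 1 = s.toMatrix 1 from rfl, s.inner_toMatrix, h1]
      simp
    · apply matRep_injective n
      ext1 q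
      refine ext_inner_left ℂ fun p => ?_
      rw [show s.toCP (gen A i) = s.toMatrix (gen A i) from rfl, s.inner_toMatrix, h2]

end W

/-! ### Extension of completely positive maps into matrices -/

section Extension

variable {S H : Type*} [CStarAlgebra S]
  [NormedAddCommGroup H] [InnerProductSpace ℂ H] {n : ℕ}

/-- The matrices over `B(H)` whose quadratic form on `Hⁿ` has nonnegative real part. No
self-adjointness is required, so that the cone lives in the space of all matrices, and contains
`M` and `-M` whenever `M` is skew-adjoint. -/
def vectorCone (n : ℕ) (H : Type*) [NormedAddCommGroup H] [InnerProductSpace ℂ H] :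
    PointedCone ℝ (Matrix (Fin n) (Fin n) (H →L[ℂ] H)) where
  carrier := {M | ∀ x : Fin n → H, 0 ≤ (∑ i, ∑ j, inner ℂ (x i) (M i j (x j))).re}
  add_mem' {M N} hM hN x := by
    have := add_nonneg (hM x) (hN x)
    simpa [inner_add_right, Finset.sum_add_distrib] using this
  zero_mem' x := by simp
  smul_mem' c M hM x := by
    have h : ∀ i j, inner ℂ (x i) ((c • M) i j (x j)) =
        ((c : ℝ) : ℂ) * inner ℂ (x i) (M i j (x j)) := by
      intro i j
      rw [← inner_smul_right]
      rfl
    simp only [h, ← Finset.mul_sum, Complex.re_ofReal_mul]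
    exact mul_nonneg c.2 (hM x)

/-- The identity matrix is an order unit for the cone. -/
lemma exists_add_mem_vectorCone (M : Matrix (Fin n) (Fin n) (H →L[ℂ] H)) :
    ∃ r : ℝ, (Matrix.diagonal fun _ => ((r : ℂ) • 1 : H →L[ℂ] H)) + M ∈ vectorCone n H := by
  refine ⟨∑ i, ∑ j, ‖M i j‖, fun x => ?_⟩
  set r := ∑ i, ∑ j, ‖M i j‖ with hr
  have h1 : ∀ i j, ‖M i j‖ * ∑ k, ‖x k‖ ^ 2 + (inner ℂ (x i) (M i j (x j))).re ≥ 0 := by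
    intro i j
    have h2 : |(inner ℂ (x i) (M i j (x j))).re| ≤ ‖M i j‖ * (‖x i‖ * ‖x j‖) := by
      calc _ ≤ ‖inner ℂ (x i) (M i j (x j))‖ := Complex.abs_re_le_norm _
        _ ≤ ‖x i‖ * ‖M i j (x j)‖ := norm_inner_le_norm _ _
        _ ≤ ‖x i‖ * (‖M i j‖ * ‖x j‖) := by gcongr; exact (M i j).le_opNorm _
        _ = _ := by ring
    have h3 : ∀ k, ‖x k‖ ^ 2 ≤ ∑ k, ‖x k‖ ^ 2 := fun k =>
      Finset.single_le_sum (f := fun k => ‖x k‖ ^ 2) (fun i _ => by positivity) (Finset.mem_univ k)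
    have h4 : ‖x i‖ * ‖x j‖ ≤ ∑ k, ‖x k‖ ^ 2 := by
      nlinarith [h3 i, h3 j, sq_nonneg (‖x i‖ - ‖x j‖)]
    have h5 := mul_le_mul_of_nonneg_left h4 (norm_nonneg (M i j))
    have := abs_le.mp (h2.trans h5)
    linarith [this.1]
  have h2 : (∑ i, ∑ j, inner ℂ (x i)
      (((Matrix.diagonal fun _ => ((r : ℂ) • 1 : H →L[ℂ] H)) + M :
        Matrix _ _ (H →L[ℂ] H)) i j (x j))).re =
      r * ∑ k, ‖x k‖ ^ 2 + ∑ i, ∑ j, (inner ℂ (x i) (M i j (x j))).re := by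
    simp only [Matrix.add_apply, add_apply, inner_add_right, Finset.sum_add_distrib, Complex.add_re,
      Complex.re_sum]
    congr 1
    rw [Finset.mul_sum]
    refine Finset.sum_congr rfl fun i _ => ?_
    rw [Finset.sum_eq_single i]
    · rw [Matrix.diagonal_apply_eq, ← inner_self_eq_norm_sq (𝕜 := ℂ)]
      simp
    · intro j _ hj
      simp [Matrix.diagonal_apply_ne' _ hj]
    · simp
  rw [h2, hr]
  simp only [Finset.sum_mul, ← Finset.sum_add_distrib]
  exact Finset.sum_nonneg fun i _ => Finset.sum_nonneg fun j _ => h1 i j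

variable [CompleteSpace H]

/-- The functional `M ↦ ∑ᵢⱼ s (M i j) eᵢ eⱼ` on `n × n` matrices over `S`, which determines the
completely positive map `s` into `M_n`. -/
noncomputable def CPForm.total (s : CPForm S (EuclideanSpace ℂ (Fin n))) :
    Matrix (Fin n) (Fin n) S →ₗ[ℂ] ℂ where
  toFun M := ∑ i, ∑ j, s (M i j) (EuclideanSpace.single i 1) (EuclideanSpace.single j 1)
  map_add' M N := by
    simp [s.add_alg, Finset.sum_add_distrib]
  map_smul' c M := by
    simp [s.smul_alg, Finset.mul_sum]

lemma CPForm.total_star (s : CPForm S (EuclideanSpace ℂ (Fin n))) (M : Matrix (Fin n) (Fin n) S) :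
    s.total (star M) = star (s.total M) := by
  simp only [CPForm.total, LinearMap.coe_mk, AddHom.coe_mk, star_sum, s.conj_symm]
  exact Finset.sum_comm

/-- The functional `s.total` is positive for the order that `M_n(S)` inherits from the
representation `ρ`. -/
lemma CPForm.total_nonneg [PartialOrder S] [StarOrderedRing S] (ρ : S →⋆ₐ[ℂ] (H →L[ℂ] H))
    (hρ : Function.Injective ρ)
    (s : CPForm S (EuclideanSpace ℂ (Fin n))) (M : Matrix (Fin n) (Fin n) S)
    (hM : M.map ρ ∈ vectorCone n H) : 0 ≤ (s.total M).re := by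
  -- `M + M*` is self-adjoint and has the same real quadratic form as `M`, up to a factor `2`
  have h1 : 0 ≤ CStarMatrix.ofMatrix (M + star M) := by
    refine nonneg_of_forall_sum_inner_nonneg ρ hρ _ ?_ fun x => ?_
    · exact IsSelfAdjoint.add_star_self (CStarMatrix.ofMatrix M)
    · have h2 := hM x
      have h3 : ∑ i, ∑ j, inner ℂ (x i) (ρ (star (M j i)) (x j)) =
          star (∑ i, ∑ j, inner ℂ (x i) (ρ (M i j) (x j))) := by
        simp only [star_sum]
        rw [Finset.sum_comm]
        refine Finset.sum_congr rfl fun i _ => Finset.sum_congr rfl fun j _ => ?_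
        rw [map_star, ContinuousLinearMap.star_eq_adjoint,
          ContinuousLinearMap.adjoint_inner_right]
        exact (inner_conj_symm _ _).symm
      have h4 : ∀ i j, inner ℂ (x i) (ρ ((CStarMatrix.ofMatrix (M + star M)) i j) (x j)) =
          inner ℂ (x i) (ρ (M i j) (x j)) + inner ℂ (x i) (ρ (star (M j i)) (x j)) := by
        intro i j
        rw [← inner_add_right, ← add_apply, ← map_add]
        rfl
      simp only [h4, Finset.sum_add_distrib, Complex.add_re, h3]
      simp only [Matrix.map_apply] at h2
      rw [Complex.star_def, Complex.conj_re]
      linarith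
  have h2 := s.nonneg_of_cstarMatrix h1 (fun i => EuclideanSpace.single i 1)
  change 0 ≤ (s.total (M + star M)).re at h2
  rw [map_add, s.total_star, Complex.add_re, Complex.star_def, Complex.conj_re] at h2
  linarith

/-- The real part of the positive functional `s.total` extends, by the Riesz extension theorem,
from matrices over `ρ(S)` to a positive functional on all matrices over `B(H)`. -/
lemma CPForm.exists_total_extension [PartialOrder S] [StarOrderedRing S]
    (ρ : S →⋆ₐ[ℂ] (H →L[ℂ] H)) (hρ : Function.Injective ρ)
    (s : CPForm S (EuclideanSpace ℂ (Fin n))) :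
    ∃ G : Matrix (Fin n) (Fin n) (H →L[ℂ] H) →ₗ[ℝ] ℝ,
      (∀ M : Matrix (Fin n) (Fin n) S, G (M.map ρ) = (s.total M).re) ∧
      ∀ M ∈ vectorCone n H, 0 ≤ G M := by
  let R : Matrix (Fin n) (Fin n) S →ₗ[ℝ] Matrix (Fin n) (Fin n) (H →L[ℂ] H) :=
    (ρ.toLinearMap.mapMatrix).restrictScalars ℝ
  have hR : ∀ M, R M = M.map ρ := fun M => rfl
  have hRi : Function.Injective R := fun M N h => Matrix.map_injective hρ h
  let e := LinearEquiv.ofInjective R hRi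
  let F : Matrix (Fin n) (Fin n) S →ₗ[ℝ] ℝ := Complex.reLm ∘ₗ s.total.restrictScalars ℝ
  let f : Matrix (Fin n) (Fin n) (H →L[ℂ] H) →ₗ.[ℝ] ℝ :=
    ⟨LinearMap.range R, F ∘ₗ e.symm.toLinearMap⟩
  have hf : ∀ M (h : R M ∈ LinearMap.range R), f ⟨R M, h⟩ = (s.total M).re := by
    intro M h
    have : e.symm ⟨R M, h⟩ = M := by
      rw [LinearEquiv.symm_apply_eq]
      rfl
    change F (e.symm ⟨R M, h⟩) = _
    rw [this]
    rfl
  have hnonneg : ∀ x : f.domain, (x : Matrix (Fin n) (Fin n) (H →L[ℂ] H)) ∈ vectorCone n H →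
      0 ≤ f x := by
    rintro ⟨_, M, rfl⟩ hx
    exact (s.total_nonneg ρ hρ M hx).trans_eq (hf M _).symm
  have hdense : ∀ M, ∃ x : f.domain,
      (x : Matrix (Fin n) (Fin n) (H →L[ℂ] H)) + M ∈ vectorCone n H := by
    intro M
    obtain ⟨r, hr⟩ := exists_add_mem_vectorCone M
    refine ⟨⟨R (Matrix.diagonal fun _ => ((r : ℂ) • 1 : S)), _, rfl⟩, ?_⟩
    have : R (Matrix.diagonal fun _ => ((r : ℂ) • 1 : S)) =
        Matrix.diagonal fun _ => ((r : ℂ) • 1 : H →L[ℂ] H) := by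
      rw [hR, Matrix.diagonal_map (map_zero ρ)]
      simp only [map_smul, map_one]
    change R (Matrix.diagonal fun _ => ((r : ℂ) • 1 : S)) + M ∈ vectorCone n H
    rwa [this]
  obtain ⟨G, hG, hG'⟩ := riesz_extension (vectorCone n H) f hnonneg hdense
  refine ⟨G, fun M => ?_, hG'⟩
  rw [← hR, ← hf M ⟨M, rfl⟩, ← hG]

/-- The extension theorem of Arveson for maps into `M_n`, combined with a compression: a completely
positive map on `S ⊆ B(H)` extends to `B(H)`, and composing the extension with
`b ↦ v* σ(b) v` gives a completely positive map on `𝒜`. -/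
lemma CPForm.exists_compression_extension [PartialOrder S] [StarOrderedRing S]
    (ρ : S →⋆ₐ[ℂ] (H →L[ℂ] H)) (hρ : Function.Injective ρ)
    (s : CPForm S (EuclideanSpace ℂ (Fin n))) {𝒜 K : Type*} [CStarAlgebra 𝒜]
    [NormedAddCommGroup K] [InnerProductSpace ℂ K] [CompleteSpace K]
    (σ : 𝒜 →⋆ₐ[ℂ] (K →L[ℂ] K)) (v : H →L[ℂ] K) :
    ∃ s' : CPForm 𝒜 (EuclideanSpace ℂ (Fin n)), ∀ a b,
      ContinuousLinearMap.adjoint v ∘L σ b ∘L v = ρ a → ∀ p q, s' b p q = s a p q := by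
  obtain ⟨G, hG, hpos⟩ := s.exists_total_extension ρ hρ
  -- `G` vanishes on skew-adjoint matrices, since these and their negatives lie in the cone
  have hstar : ∀ M, G (star M) = G M := by
    intro M
    have h0 : ∀ x : Fin n → H, (∑ i, ∑ j, inner ℂ (x i) ((M - star M) i j (x j))).re = 0 := by
      intro x
      have h3 : ∑ i, ∑ j, inner ℂ (x i) (star M i j (x j)) =
          star (∑ i, ∑ j, inner ℂ (x i) (M i j (x j))) := by
        simp only [star_sum]
        rw [Finset.sum_comm]
        refine Finset.sum_congr rfl fun i _ => Finset.sum_congr rfl fun j _ => ?_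
        rw [Matrix.star_apply, ContinuousLinearMap.star_eq_adjoint,
          ContinuousLinearMap.adjoint_inner_right]
        exact (inner_conj_symm _ _).symm
      simp only [Matrix.sub_apply, sub_apply, inner_sub_right, Finset.sum_sub_distrib, h3,
        Complex.sub_re, Complex.star_def, Complex.conj_re, sub_self]
    have h1 : 0 ≤ G (M - star M) := hpos _ fun x => (h0 x).ge
    have h2 : 0 ≤ G (-(M - star M)) := hpos _ fun x => by
      simpa using (h0 x).le
    rw [map_neg] at h2
    rw [map_sub] at h1 h2
    linarith
  -- the complex functional `L` below, evaluated on `C T p q`, is the form of the extension at `T`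
  let C : (H →L[ℂ] H) → EuclideanSpace ℂ (Fin n) → EuclideanSpace ℂ (Fin n) →
    Matrix (Fin n) (Fin n) (H →L[ℂ] H) := fun T p q =>
      Matrix.of fun i j => (star (p i) * q j) • T
  -- the complex-linear functional with real part `G`
  let Gc : Matrix (Fin n) (Fin n) (H →L[ℂ] H) → ℂ := fun M =>
    G M - Complex.I * G (Complex.I • M)
  have hGadd : ∀ M N, Gc (M + N) = Gc M + Gc N := by
    intro M N
    simp only [Gc, smul_add, map_add, Complex.ofReal_add]
    ring
  have hGsmul : ∀ (c : ℂ) M, Gc (c • M) = c * Gc M := by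
    intro c M
    have h1 : ∀ M, G (c • M) = c.re * G M + c.im * G (Complex.I • M) := by
      intro M
      have : c • M = c.re • M + c.im • (Complex.I • M) := by
        ext i j x
        simp only [Matrix.smul_apply, Matrix.add_apply, add_apply, smul_apply]
        rw [← Complex.coe_smul, ← Complex.coe_smul, smul_smul, ← add_smul, Complex.re_add_im]
      rw [this, map_add, map_smul, map_smul, smul_eq_mul, smul_eq_mul]
    have h2 : Complex.I • Complex.I • M = - M := by
      rw [smul_smul, Complex.I_mul_I, neg_one_smul]
    simp only [Gc]
    rw [smul_comm Complex.I c M, h1, h1, h2, map_neg]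
    conv_rhs => rw [← Complex.re_add_im c]
    push_cast
    linear_combination (c.im : ℂ) * (G (Complex.I • M)) * Complex.I_sq
  let L : Matrix (Fin n) (Fin n) (H →L[ℂ] H) →ₗ[ℂ] ℂ := ⟨⟨Gc, hGadd⟩, hGsmul⟩
  have hLre : ∀ M, (L M).re = G M := by
    intro M
    change (G M - Complex.I * G (Complex.I • M) : ℂ).re = _
    simp
  have hLstar : ∀ M, L (star M) = star (L M) := by
    intro M
    change (G (star M) - Complex.I * G (Complex.I • star M) : ℂ) =
      star (G M - Complex.I * G (Complex.I • M) : ℂ)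
    have : Complex.I • star M = star (-(Complex.I • M)) := by
      rw [star_neg, star_smul, Complex.star_def, Complex.conj_I, neg_smul, neg_neg]
    rw [this, hstar, hstar, map_neg]
    simp
  let cmp : 𝒜 → (H →L[ℂ] H) := fun b => ContinuousLinearMap.adjoint v ∘L σ b ∘L v
  have hcmp : ∀ b x y, inner ℂ x (cmp b y) = inner ℂ (v x) (σ b (v y)) := fun b x y =>
    ContinuousLinearMap.adjoint_inner_right v _ _
  have hcmp_star : ∀ b, cmp (star b) = star (cmp b) := by
    intro b
    simp only [cmp, map_star, ContinuousLinearMap.star_eq_adjoint,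
      ContinuousLinearMap.adjoint_comp, ContinuousLinearMap.adjoint_adjoint]
    rfl
  let s' : CPForm 𝒜 (EuclideanSpace ℂ (Fin n)) :=
    { toFun := fun b p q => L (C (cmp b) p q)
      add_alg := fun a b p q => by
        rw [← map_add]
        congr 1
        ext i j x
        simp [C, cmp]
      smul_alg := fun c a p q => by
        rw [← smul_eq_mul, ← map_smul]
        congr 1
        ext i j x
        simp [C, cmp, smul_smul, mul_comm]
      add_right := fun a p q q' => by
        rw [← map_add]
        congr 1
        ext i j x
        simp [C, mul_add, add_smul]
      smul_right := fun a p c q => by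
        rw [← smul_eq_mul, ← map_smul]
        congr 1
        ext i j x
        simp [C, smul_smul, mul_left_comm]
      conj_symm := fun a p q => by
        rw [← hLstar, hcmp_star]
        congr 1
        ext1 i j
        simp [C, Matrix.star_apply, mul_comm]
      pos := fun m a x => by
        simp only [← map_sum]
        rw [hLre]
        refine hpos _ fun h => ?_
        -- the quadratic form at `h` is `‖∑ᵢₖ (x k i) σ(a k) v (h i)‖²`
        have key : ∑ i, ∑ j, inner ℂ (h i)
            ((∑ k, ∑ l, C (cmp (star (a k) * a l)) (x k) (x l)) i j (h j)) =
            inner ℂ (∑ i, ∑ k, x k i • σ (a k) (v (h i)))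
              (∑ i, ∑ k, x k i • σ (a k) (v (h i))) := by
          trans ∑ i, ∑ j, ∑ k, ∑ l, star (x k i) * x l j *
            inner ℂ (σ (a k) (v (h i))) (σ (a l) (v (h j)))
          · simp only [Matrix.sum_apply, sum_apply, inner_sum, C, Matrix.of_apply, smul_apply,
              inner_smul_right, hcmp, ← inner_map_map]
          · rw [sum_inner]
            refine Finset.sum_congr rfl fun i _ => ?_
            rw [inner_sum]
            refine Finset.sum_congr rfl fun j _ => ?_
            rw [sum_inner]
            refine Finset.sum_congr rfl fun k _ => ?_
            rw [inner_sum]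
            refine Finset.sum_congr rfl fun l _ => ?_
            rw [inner_smul_left, inner_smul_right, mul_assoc]
            rfl
        rw [key]
        exact inner_self_nonneg (𝕜 := ℂ) }
  refine ⟨s', fun a b hab p q => ?_⟩
  have h1 : ∀ M : Matrix (Fin n) (Fin n) S, L (M.map ρ) = s.total M := by
    intro M
    have hI : Complex.I • M.map ρ = (Complex.I • M).map ρ := by
      ext1 i j
      simp
    change (G (M.map ρ) - Complex.I * G (Complex.I • M.map ρ) : ℂ) = _
    rw [hI, hG, hG, map_smul]
    apply Complex.ext <;> simp
  have h2 : C (cmp b) p q = (Matrix.of fun i j => (star (p i) * q j) • a).map ρ := by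
    ext1 i j
    simp [C, cmp, hab]
  change L (C (cmp b) p q) = _
  rw [h2, h1]
  conv_rhs => rw [euclidean_eq_sum p, euclidean_eq_sum q]
  simp only [CPForm.total, LinearMap.coe_mk, AddHom.coe_mk, s.map_sum_left, s.map_sum_right,
    s.smul_left, s.smul_right, Matrix.of_apply, s.smul_alg, mul_assoc]

/-- Composition with a `*`-homomorphism of the algebra. -/
def CPForm.comp {𝒜 ℬ E : Type*} [CStarAlgebra 𝒜] [CStarAlgebra ℬ] [AddCommGroup E] [Module ℂ E]
    (s : CPForm 𝒜 E) (f : ℬ →⋆ₐ[ℂ] 𝒜) : CPForm ℬ E where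
  toFun b := s (f b)
  add_alg a b x y := by rw [map_add, s.add_alg]
  smul_alg c a x y := by rw [map_smul, s.smul_alg]
  add_right a x y z := s.add_right _ _ _ _
  smul_right a x c y := s.smul_right _ _ _ _
  conj_symm a x y := by rw [map_star, s.conj_symm]
  pos m a x := by
    simp only [map_mul, map_star]
    exact s.pos m _ x

end Extension

section Dilation

variable {d : ℕ} {H K : Type u}
  [NormedAddCommGroup H] [InnerProductSpace ℂ H] [CompleteSpace H]
  [NormedAddCommGroup K] [InnerProductSpace ℂ K] [CompleteSpace K]

/-- If `A ≺ cB`, then `W n A ⊆ c • W n B`. -/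
lemma Dilates.exists_smul_eq {A : Fin d → (H →L[ℂ] H)} {B : Fin d → (K →L[ℂ] K)} {c : ℝ}
    (h : Dilates A c B) (hc : 0 < c) {n : ℕ} {X : MatTuple d n} (hX : X ∈ W n A) :
    ∃ Y ∈ W n B, X = (c : ℂ) • Y := by
  obtain ⟨H', K', _, _, _, _, _, _, ι, U, V, ⟨πA, hA⟩, ⟨πB, hB⟩, hUV⟩ := h
  obtain ⟨s, hs1, hs⟩ := mem_W_iff.mp hX
  have hc' : (c : ℂ) ≠ 0 := by exact_mod_cast hc.ne'
  let t : CPForm (cstarGen U) (EuclideanSpace ℂ (Fin n)) :=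
    s.comp (πA.symm : cstarGen U →⋆ₐ[ℂ] cstarGen A)
  obtain ⟨s', hs'⟩ := t.exists_compression_extension (cstarGen U).subtype Subtype.val_injective
    ((cstarGen V).subtype.comp (πB : cstarGen B →⋆ₐ[ℂ] cstarGen V)) ι.toContinuousLinearMap
  refine ⟨(c : ℂ)⁻¹ • X, mem_W_iff.mpr ⟨s', fun p q => ?_, fun i p q => ?_⟩, ?_⟩
  -- `ι* 1 ι = 1`, because `ι` is an isometry
  · rw [hs' 1 1, ← hs1]
    · change s (πA.symm 1) p q = s 1 p q
      rw [map_one]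
    · ext x
      refine ext_inner_left ℂ fun y => ?_
      simp [ContinuousLinearMap.adjoint_inner_right]
  -- `ι* (c V_i) ι = U_i`
  · have h1 := hs' (gen U i) ((c : ℂ) • gen B i) (by
      rw [map_smul]
      change _ ∘L ((c : ℂ) • ((πB (gen B i) : cstarGen V) : K' →L[ℂ] K')) ∘L _ = U i
      rw [hB, hUV i]
      rfl) p q
    have h2 : t (gen U i) p q = s (gen A i) p q := by
      change s (πA.symm (gen U i)) p q = _
      rw [← hA, StarAlgEquiv.symm_apply_apply]
    rw [s'.smul_alg, h2, hs] at h1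
    rw [Pi.smul_apply, map_smul, smul_apply, inner_smul_right, ← h1, inv_mul_cancel_left₀ hc']
  · rw [smul_inv_smul₀ hc']

end Dilation

/-! ### Stinespring's construction -/

section Stinespring

open UniformSpace

variable {𝒜 E : Type*} [CStarAlgebra 𝒜] [AddCommGroup E] [Module ℂ E]

namespace CPForm

/-- Positivity of the kernel of `s` on a finite set of algebra elements. -/
lemma sum_nonneg_of_finset (s : CPForm 𝒜 E) (t : Finset 𝒜) (x : 𝒜 → E) :
    0 ≤ (∑ a ∈ t, ∑ b ∈ t, s (star a * b) (x a) (x b)).re := by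
  have h := s.pos t.card (fun i => (t.equivFin.symm i : 𝒜)) (fun i => x (t.equivFin.symm i))
  have h1 : ∀ f : 𝒜 → ℂ, ∑ i, f (t.equivFin.symm i : 𝒜) = ∑ a ∈ t, f a := fun f => by
    rw [← Finset.sum_coe_sort t f]
    exact t.equivFin.symm.sum_comp (fun a : t => f a)
  rw [← h1]
  simpa only [← h1] using h

/-- The sesquilinear form on `𝒜 →₀ E` with kernel `((a, x), (b, y)) ↦ s (a* b) x y`. -/
noncomputable def formSum (s : CPForm 𝒜 E) (f g : 𝒜 →₀ E) : ℂ :=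
  f.sum fun a x => g.sum fun b y => s (star a * b) x y

lemma conj_formSum (s : CPForm 𝒜 E) (f g : 𝒜 →₀ E) :
    star (s.formSum g f) = s.formSum f g := by
  simp only [formSum, Finsupp.sum, star_sum, s.conj_symm, star_mul, star_star]
  exact Finset.sum_comm

lemma formSum_add_left (s : CPForm 𝒜 E) (f g h : 𝒜 →₀ E) :
    s.formSum (f + g) h = s.formSum f h + s.formSum g h := by
  refine Finsupp.sum_add_index' (fun a => ?_) (fun a x y => ?_)
  · simp [s.map_zero_left]
  · simp [s.add_left]

lemma formSum_smul_left (s : CPForm 𝒜 E) (f g : 𝒜 →₀ E) (c : ℂ) :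
    s.formSum (c • f) g = star c * s.formSum f g := by
  refine (Finsupp.sum_smul_index' (fun a => ?_)).trans ?_
  · simp [s.map_zero_left]
  · simp only [formSum, Finsupp.sum, s.smul_left, Finset.mul_sum]

lemma formSum_single (s : CPForm 𝒜 E) (a b : 𝒜) (x y : E) :
    s.formSum (Finsupp.single a x) (Finsupp.single b y) = s (star a * b) x y := by
  refine (Finsupp.sum_single_index ?_).trans (Finsupp.sum_single_index ?_)
  · simp [s.map_zero_left]
  · simp [s.map_zero_right]

/-- The space `𝒜 →₀ E`, as a type synonym that carries the semi-inner product `s.formSum`. It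
replaces the algebraic tensor product `𝒜 ⊗ E`; the two have the same Hausdorff completion. -/
def PreSpace (_ : CPForm 𝒜 E) := 𝒜 →₀ E

variable (s : CPForm 𝒜 E)

noncomputable instance : AddCommGroup s.PreSpace := inferInstanceAs (AddCommGroup (𝒜 →₀ E))
noncomputable instance : Module ℂ s.PreSpace := inferInstanceAs (Module ℂ (𝒜 →₀ E))

/-- The elementary vector `a ⊗ x`. -/
noncomputable def elem (a : 𝒜) : E →ₗ[ℂ] s.PreSpace := Finsupp.lsingle a

/-- The semi-inner product `s.formSum`. -/
noncomputable abbrev preCore : PreInnerProductSpace.Core ℂ s.PreSpace where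
  inner f g := s.formSum f g
  conj_inner_symm f g := s.conj_formSum f g
  re_inner_nonneg f := s.sum_nonneg_of_finset (Finsupp.support f) (fun a => Finsupp.toFun f a)
  add_left f g h := s.formSum_add_left f g h
  smul_left f g c := s.formSum_smul_left f g c

noncomputable instance : SeminormedAddCommGroup s.PreSpace :=
  InnerProductSpace.Core.toSeminormedAddCommGroup (c := s.preCore)
noncomputable instance : InnerProductSpace ℂ s.PreSpace := InnerProductSpace.ofCore s.preCore

lemma inner_elem (a b : 𝒜) (x y : E) :
    inner ℂ (s.elem a x) (s.elem b y) = s (star a * b) x y := s.formSum_single a b x y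

/-- Left multiplication `a ⊗ x ↦ ca ⊗ x`. It depends linearly on `c` only up to vectors of
length `0`. -/
noncomputable def leftMulLin (c : 𝒜) : s.PreSpace →ₗ[ℂ] s.PreSpace :=
  Finsupp.lmapDomain E ℂ (c * ·)

lemma leftMulLin_elem (c a : 𝒜) (x : E) : s.leftMulLin c (s.elem a x) = s.elem (c * a) x :=
  Finsupp.mapDomain_single

lemma induction_elem {p : s.PreSpace → Prop} (h0 : p 0) (hadd : ∀ f g, p f → p g → p (f + g))
    (he : ∀ a x, p (s.elem a x)) (f : s.PreSpace) : p f :=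
  Finsupp.induction_linear f h0 hadd he

lemma inner_leftMulLin_right (c : 𝒜) (f g : s.PreSpace) :
    inner ℂ f (s.leftMulLin c g) = inner ℂ (s.leftMulLin (star c) f) g := by
  induction f using s.induction_elem with
  | h0 => simp
  | hadd f₁ f₂ h₁ h₂ => simp only [inner_add_left, map_add, h₁, h₂]
  | he a x =>
    induction g using s.induction_elem with
    | h0 => simp
    | hadd f₁ f₂ h₁ h₂ => simp only [inner_add_right, map_add, h₁, h₂]
    | he b y => simp only [leftMulLin_elem, inner_elem, star_mul, star_star, mul_assoc]

lemma inner_leftMulLin_add (a b : 𝒜) (f g : s.PreSpace) :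
    inner ℂ f (s.leftMulLin (a + b) g) =
      inner ℂ f (s.leftMulLin a g) + inner ℂ f (s.leftMulLin b g) := by
  induction f using s.induction_elem with
  | h0 => simp
  | hadd f₁ f₂ h₁ h₂ => simp only [inner_add_left, h₁, h₂]; ring
  | he a x =>
    induction g using s.induction_elem with
    | h0 => simp
    | hadd f₁ f₂ h₁ h₂ => simp only [inner_add_right, map_add, h₁, h₂]; ring
    | he b y => simp only [leftMulLin_elem, inner_elem, add_mul, mul_add, s.add_alg]

lemma inner_leftMulLin_smul (c : ℂ) (a : 𝒜) (f g : s.PreSpace) :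
    inner ℂ f (s.leftMulLin (c • a) g) = c * inner ℂ f (s.leftMulLin a g) := by
  induction f using s.induction_elem with
  | h0 => simp
  | hadd f₁ f₂ h₁ h₂ => simp only [inner_add_left, h₁, h₂]; ring
  | he a x =>
    induction g using s.induction_elem with
    | h0 => simp
    | hadd f₁ f₂ h₁ h₂ => simp only [inner_add_right, map_add, h₁, h₂]; ring
    | he b y => simp only [leftMulLin_elem, inner_elem, smul_mul_assoc, mul_smul_comm, s.smul_alg]

lemma leftMulLin_mul (a b : 𝒜) (f : s.PreSpace) :
    s.leftMulLin (a * b) f = s.leftMulLin a (s.leftMulLin b f) := by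
  induction f using s.induction_elem with
  | h0 => simp
  | hadd f₁ f₂ h₁ h₂ => simp only [map_add, h₁, h₂]
  | he c x => simp only [leftMulLin_elem, mul_assoc]

lemma leftMulLin_one (f : s.PreSpace) : s.leftMulLin 1 f = f := by
  induction f using s.induction_elem with
  | h0 => simp
  | hadd f₁ f₂ h₁ h₂ => simp only [map_add, h₁, h₂]
  | he c x => simp only [leftMulLin_elem, one_mul]

/-- The element `‖c‖² - c* c` is positive, hence of the form `d* d`. -/
lemma exists_star_mul_self_add (c : 𝒜) :
    ∃ d : 𝒜, star c * c + star d * d = ((‖c‖ ^ 2 : ℝ) : ℂ) • (1 : 𝒜) := by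
  let _ := CStarAlgebra.spectralOrder 𝒜
  let _ := CStarAlgebra.spectralOrderedRing 𝒜
  have h : star c * c ≤ algebraMap ℝ 𝒜 ‖star c * c‖ :=
    IsSelfAdjoint.le_algebraMap_norm_self (IsSelfAdjoint.star_mul_self c)
  obtain ⟨d, hd⟩ := exists_eq_star_mul_self_of_nonneg (sub_nonneg.mpr h)
  refine ⟨d, ?_⟩
  rw [← hd, add_sub_cancel, CStarRing.norm_star_mul_self, ← sq, Algebra.algebraMap_eq_smul_one]
  rfl

lemma norm_leftMulLin_le (c : 𝒜) (f : s.PreSpace) : ‖s.leftMulLin c f‖ ≤ ‖c‖ * ‖f‖ := by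
  obtain ⟨d, hd⟩ := exists_star_mul_self_add c
  have h : ∀ c, inner ℂ (s.leftMulLin c f) (s.leftMulLin c f) =
      inner ℂ f (s.leftMulLin (star c * c) f) := by
    intro c
    rw [leftMulLin_mul, inner_leftMulLin_right s (star c), star_star]
  have h2 := s.inner_leftMulLin_add (star c * c) (star d * d) f f
  rw [hd, inner_leftMulLin_smul, leftMulLin_one, ← h, ← h, inner_self_eq_norm_sq_to_K,
    inner_self_eq_norm_sq_to_K, inner_self_eq_norm_sq_to_K] at h2
  have h3 : ‖c‖ ^ 2 * ‖f‖ ^ 2 = ‖s.leftMulLin c f‖ ^ 2 + ‖s.leftMulLin d f‖ ^ 2 := by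
    apply Complex.ofReal_injective
    push_cast
    simpa using h2
  refine le_of_sq_le_sq ?_ (by positivity)
  rw [mul_pow, h3]
  nlinarith [sq_nonneg ‖s.leftMulLin d f‖]

/-- Left multiplication as a bounded operator. -/
noncomputable def leftMul (c : 𝒜) : s.PreSpace →L[ℂ] s.PreSpace :=
  (s.leftMulLin c).mkContinuous ‖c‖ (s.norm_leftMulLin_le c)

lemma leftMul_apply (c : 𝒜) (f : s.PreSpace) : s.leftMul c f = s.leftMulLin c f := rfl

lemma completion_ext {x y : Completion s.PreSpace}
    (h : ∀ f : s.PreSpace, inner ℂ (f : Completion s.PreSpace) x =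
      inner ℂ (f : Completion s.PreSpace) y) : x = y :=
  Completion.denseRange_coe.eq_of_inner_right ℂ h

/-- The representation of `𝒜` on the completion of `s.PreSpace` by left multiplication. -/
noncomputable def rep : 𝒜 →⋆ₐ[ℂ]
    (Completion s.PreSpace →L[ℂ] Completion s.PreSpace) where
  toFun a := (s.leftMul a).completion
  map_one' := by
    ext c
    induction c using Completion.induction_on with
    | hp => apply isClosed_eq <;> fun_prop
    | ih f => simp [leftMul_apply, leftMulLin_one]
  map_mul' a b := by
    ext c
    induction c using Completion.induction_on with
    | hp => apply isClosed_eq <;> fun_prop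
    | ih f => simp [leftMul_apply, leftMulLin_mul]
  map_zero' := by
    ext c
    induction c using Completion.induction_on with
    | hp => apply isClosed_eq <;> fun_prop
    | ih f =>
      refine s.completion_ext fun g => ?_
      have := s.inner_leftMulLin_smul 0 0 g f
      rw [zero_smul, zero_mul] at this
      simpa [leftMul_apply] using this
  map_add' a b := by
    ext c
    induction c using Completion.induction_on with
    | hp => apply isClosed_eq <;> fun_prop
    | ih f =>
      refine s.completion_ext fun g => ?_
      simpa [leftMul_apply, inner_add_right] using s.inner_leftMulLin_add a b g f
  commutes' r := by
    ext c
    induction c using Completion.induction_on with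
    | hp => apply isClosed_eq <;> fun_prop
    | ih f =>
      refine s.completion_ext fun g => ?_
      have := s.inner_leftMulLin_smul r 1 g f
      rw [leftMulLin_one] at this
      simpa [leftMul_apply, inner_smul_right, Algebra.algebraMap_eq_smul_one] using this
  map_star' a := by
    refine (ContinuousLinearMap.eq_adjoint_iff _ _).mpr fun x y => ?_
    induction x, y using Completion.induction_on₂ with
    | hp => apply isClosed_eq <;> fun_prop
    | ih f g => simp [leftMul_apply, inner_leftMulLin_right]

/-- The map `x ↦ 1 ⊗ x` from `E` to the Stinespring space. -/
noncomputable def cyclic : E →ₗ[ℂ] Completion s.PreSpace :=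
  (Completion.toComplL (𝕜 := ℂ) (E := s.PreSpace)).toLinearMap ∘ₗ s.elem 1

lemma inner_cyclic_rep (a : 𝒜) (x y : E) :
    inner ℂ (s.cyclic x) (s.rep a (s.cyclic y)) = s a x y := by
  have : s.rep a (s.cyclic y) = (s.elem a y : Completion s.PreSpace) := by
    change (s.leftMul a).completion (s.elem 1 y : Completion s.PreSpace) = _
    rw [ContinuousLinearMap.completion_apply_coe, leftMul_apply, leftMulLin_elem, mul_one]
  rw [this]
  change inner ℂ (s.elem 1 x : Completion s.PreSpace) _ = _
  rw [Completion.inner_coe, inner_elem, star_one, one_mul]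

/-- The direct sum of the completely positive map `s` and the representation `ρ`. -/
noncomputable def prodRep {𝒜 E K : Type*} [CStarAlgebra 𝒜] [AddCommGroup E] [Module ℂ E]
    [NormedAddCommGroup K] [InnerProductSpace ℂ K] [CompleteSpace K]
    (s : CPForm 𝒜 E) (ρ : 𝒜 →⋆ₐ[ℂ] (K →L[ℂ] K)) : CPForm 𝒜 (E × K) where
  toFun a p q := s a p.1 q.1 + inner ℂ p.2 (ρ a q.2)
  add_alg a b x y := by
    rw [s.add_alg, map_add, add_apply, inner_add_right]; ring
  smul_alg a b x y := by
    rw [s.smul_alg, map_smul, smul_apply, inner_smul_right]; ring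
  add_right a x y z := by
    rw [Prod.fst_add, Prod.snd_add, s.add_right, map_add, inner_add_right]; ring
  smul_right a x c y := by
    rw [Prod.smul_fst, Prod.smul_snd, s.smul_right, map_smul, inner_smul_right]; ring
  conj_symm a x y := by
    rw [star_add, s.conj_symm]
    exact congrArg _ ((ofRep ρ).conj_symm a x.2 y.2)
  pos m a x := by
    have h := s.pos m a (fun i => (x i).1)
    have h' := (ofRep ρ).pos m a (fun i => (x i).2)
    simp only [Finset.sum_add_distrib, Complex.add_re]
    exact add_nonneg h h'

lemma prodRep_apply {𝒜 E K : Type*} [CStarAlgebra 𝒜] [AddCommGroup E] [Module ℂ E]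
    [NormedAddCommGroup K] [InnerProductSpace ℂ K] [CompleteSpace K]
    (s : CPForm 𝒜 E) (ρ : 𝒜 →⋆ₐ[ℂ] (K →L[ℂ] K)) (a : 𝒜) (p q : E × K) :
    s.prodRep ρ a p q = s a p.1 q.1 + inner ℂ p.2 (ρ a q.2) := rfl

/-- Stinespring's dilation theorem: every completely positive map is a compression of a
`*`-representation. The universe of the Hilbert space is the common one of `𝒜` and `E`. -/
theorem exists_stinespring {𝒜 E : Type u} [CStarAlgebra 𝒜] [AddCommGroup E] [Module ℂ E]
    (s : CPForm 𝒜 E) :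
    ∃ (L : Type u) (_ : NormedAddCommGroup L) (_ : InnerProductSpace ℂ L) (_ : CompleteSpace L)
      (π : 𝒜 →⋆ₐ[ℂ] (L →L[ℂ] L)) (κ : E →ₗ[ℂ] L),
      ∀ a x y, inner ℂ (κ x) (π a (κ y)) = s a x y :=
  ⟨UniformSpace.Completion s.PreSpace, inferInstance, inferInstance, inferInstance,
    s.rep, s.cyclic, s.inner_cyclic_rep⟩

end CPForm

end Stinespring

/-! ### From completely positive maps to dilations -/

section Dilation

variable {d : ℕ} {H K : Type u}
  [NormedAddCommGroup H] [InnerProductSpace ℂ H] [CompleteSpace H]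
  [NormedAddCommGroup K] [InnerProductSpace ℂ K] [CompleteSpace K]

/-- A faithful representation `π` of `C*(B)` is a `*`-isomorphism onto the algebra generated by the
operators `π(B_i)`. -/
lemma starEquivalent_of_injective {B : Fin d → (K →L[ℂ] K)} (π : cstarGen B →⋆ₐ[ℂ] (H →L[ℂ] H))
    (hπ : Function.Injective π) : StarEquivalent B (fun i => π (gen B i)) := by
  set V := fun i => π (gen B i) with hV
  have hiso : Isometry π := NonUnitalStarAlgHom.isometry π hπ
  have h1 : ∀ a, π a ∈ cstarGen V := by
    have hadj : ∀ b ∈ StarAlgebra.adjoin ℂ (Set.range B), ∀ h : b ∈ cstarGen B,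
        π ⟨b, h⟩ ∈ cstarGen V := by
      intro b hb
      induction hb using StarAlgebra.adjoin_induction with
      | mem x hx =>
        obtain ⟨i, rfl⟩ := hx
        intro h
        exact StarSubalgebra.le_topologicalClosure _
          (StarAlgebra.subset_adjoin ℂ _ (Set.mem_range_self i))
      | algebraMap r =>
        intro h
        have : π ⟨algebraMap ℂ (K →L[ℂ] K) r, h⟩ = algebraMap ℂ _ r :=
          AlgHomClass.commutes π r
        rw [this]
        exact algebraMap_mem _ r
      | add x y hx hy ihx ihy =>
        intro h
        have hx' := StarSubalgebra.le_topologicalClosure _ hx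
        have hy' := StarSubalgebra.le_topologicalClosure _ hy
        have := add_mem (ihx hx') (ihy hy')
        rwa [← map_add] at this
      | mul x y hx hy ihx ihy =>
        intro h
        have hx' := StarSubalgebra.le_topologicalClosure _ hx
        have hy' := StarSubalgebra.le_topologicalClosure _ hy
        have := mul_mem (ihx hx') (ihy hy')
        rwa [← map_mul] at this
      | star x hx ihx =>
        intro h
        have := star_mem (ihx (StarSubalgebra.le_topologicalClosure _ hx))
        rwa [← map_star] at this
    intro a
    have hcl : IsClosed {a | π a ∈ cstarGen V} :=
      (isClosed_cstarGen V).preimage hiso.continuous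
    have ha : a ∈ closure (Subtype.val ⁻¹'
        (StarAlgebra.adjoin ℂ (Set.range B) : Set (K →L[ℂ] K))) := by
      rw [closure_subtype]
      have : Subtype.val '' ((Subtype.val : cstarGen B → K →L[ℂ] K) ⁻¹'
          (StarAlgebra.adjoin ℂ (Set.range B) : Set (K →L[ℂ] K))) =
          (StarAlgebra.adjoin ℂ (Set.range B) : Set (K →L[ℂ] K)) :=
        (Subtype.image_preimage_coe _ _).trans
          (inter_eq_right.mpr (StarSubalgebra.le_topologicalClosure _))
      rw [this]
      exact a.2
    exact closure_minimal (s := Subtype.val ⁻¹' (StarAlgebra.adjoin ℂ (Set.range B) :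
      Set (K →L[ℂ] K))) (fun b hb => hadj b hb (Subtype.prop b)) hcl ha
  have h2 : cstarGen V ≤ π.range := by
    refine StarSubalgebra.topologicalClosure_minimal (StarAlgebra.adjoin_le ?_) ?_
    · rintro _ ⟨i, rfl⟩
      exact ⟨_, rfl⟩
    · exact hiso.isClosedEmbedding.isClosed_range
  let f : cstarGen B →⋆ₐ[ℂ] cstarGen V := π.codRestrict _ h1
  have hf : Function.Bijective f := by
    refine ⟨fun a b h => hπ (congrArg Subtype.val h), fun ⟨b, hb⟩ => ?_⟩
    obtain ⟨a, rfl⟩ := h2 hb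
    exact ⟨a, rfl⟩
  exact ⟨StarAlgEquiv.ofBijective f hf, fun i => Subtype.ext rfl⟩

/-- A unital completely positive map `C*(B) → B(H)` with `c B_i ↦ A_i` gives `A ≺ cB`. Its
Stinespring representation need not be faithful, whence the direct sum with the identity
representation of `C*(B)`. -/
lemma dilates_of_cpForm {A : Fin d → (H →L[ℂ] H)} {B : Fin d → (K →L[ℂ] K)} {c : ℝ}
    (s : CPForm (cstarGen B) H) (h1 : ∀ x y, s 1 x y = inner ℂ x y)
    (h2 : ∀ i x y, c * s (gen B i) x y = inner ℂ x (A i y)) : Dilates A c B := by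
  set ρ : cstarGen B →⋆ₐ[ℂ] (K →L[ℂ] K) := (cstarGen B).subtype with hρ
  obtain ⟨L, _, _, _, π, κ, ht⟩ := (s.prodRep ρ).exists_stinespring
  let ι : H →ₗᵢ[ℂ] L :=
    { toLinearMap := κ ∘ₗ LinearMap.inl ℂ H K
      norm_map' := fun x => by
        have h := ht 1 (x, 0) (x, 0)
        rw [map_one, CPForm.prodRep_apply, h1, inner_zero_left, add_zero, one_apply_eq_self,
          inner_self_eq_norm_sq_to_K, inner_self_eq_norm_sq_to_K] at h
        have h'' : ‖κ (x, 0)‖ ^ 2 = ‖x‖ ^ 2 := by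
          apply Complex.ofReal_injective
          push_cast
          exact h
        exact (sq_eq_sq₀ (norm_nonneg _) (norm_nonneg _)).mp h'' }
  have hinj : Function.Injective π := by
    rw [injective_iff_map_eq_zero]
    intro a ha
    have h0 : ρ a = 0 := by
      ext u
      have h := ht (star a * a) (0, u) (0, u)
      rw [map_mul, ha, mul_zero, CPForm.prodRep_apply, s.map_zero_left, zero_add,
        ← inner_map_map, zero_apply, inner_zero_right] at h
      simpa using inner_self_eq_zero.mp h.symm
    exact Subtype.ext h0
  refine ⟨H, L, inferInstance, inferInstance, inferInstance, inferInstance, inferInstance,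
    inferInstance, ι, A, fun i => π (gen B i), ⟨StarAlgEquiv.refl _ _, fun i => rfl⟩,
    starEquivalent_of_injective π hinj, fun i => ?_⟩
  ext y
  refine ext_inner_left ℂ fun x => ?_
  have h := ht (gen B i) (x, 0) (y, 0)
  rw [CPForm.prodRep_apply, inner_zero_left, add_zero] at h
  rw [← h2, ← h, ContinuousLinearMap.comp_apply, ContinuousLinearMap.adjoint_inner_right]
  exact (inner_smul_right _ _ _).symm

end Dilation

/-! ### Limits of completely positive maps -/

namespace CPForm

variable {𝒜 E : Type*} [CStarAlgebra 𝒜] [AddCommGroup E] [Module ℂ E]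

lemma re_star_mul_self_le (s : CPForm 𝒜 E) (a : 𝒜) (x : E) :
    (s (star a * a) x x).re ≤ ‖a‖ ^ 2 * (s 1 x x).re := by
  obtain ⟨d, hd⟩ := exists_star_mul_self_add a
  have h := s.add_alg (star a * a) (star d * d) x x
  rw [hd, s.smul_alg] at h
  have h2 := congrArg Complex.re h
  rw [Complex.re_ofReal_mul, Complex.add_re] at h2
  linarith [s.pos_self d x]

/-- A bound that depends only on `a` and on the forms at `1`, which makes ultrafilter limits
possible. -/
lemma norm_apply_le (s : CPForm 𝒜 E) (a : 𝒜) (x y : E) :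
    ‖s a x y‖ ≤ (s 1 x x).re + ‖a‖ ^ 2 * (s 1 y y).re := by
  have h1 : 0 ≤ (s 1 x x).re := by simpa using s.pos_self 1 x
  have h2 := s.re_star_mul_self_le a y
  have h3 := s.pos_self a y
  rcases eq_or_ne (s a x y) 0 with h0 | h0
  · rw [h0, norm_zero]
    linarith
  set w := s a x y with hw
  -- positivity at the pairs `(1, x)` and `(a, z y)`, where the unimodular `z` makes `z w = -‖w‖`
  set z : ℂ := -(star w / ‖w‖) with hz
  have hn : (‖w‖ : ℂ) ≠ 0 := by simpa using h0
  have hww : star w * w = (‖w‖ : ℂ) ^ 2 := by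
    rw [mul_comm]; exact Complex.mul_conj' w
  have hzw : z * w = -(‖w‖ : ℂ) := by
    rw [hz, neg_mul, div_mul_eq_mul_div, hww]
    field_simp
  have hzz : star z * z = 1 := by
    have : star z = -(w / ‖w‖) := by
      rw [hz, star_neg, star_div₀, star_star]
      simp
    rw [this, hz, neg_mul_neg, div_mul_div_comm, mul_comm w, hww]
    field_simp
  have h := s.pos 2 ![1, a] ![x, z • y]
  have h4 : s (star a) y x = star w := by rw [hw, s.conj_symm]
  simp only [Fin.sum_univ_two, Matrix.cons_val_zero, Matrix.cons_val_one, star_one, one_mul,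
    mul_one, s.smul_right, s.smul_left] at h
  rw [h4, ← mul_assoc z (star z), mul_comm z (star z), hzz, ← star_mul', ← hw, hzw] at h
  simp only [Complex.add_re, Complex.neg_re, Complex.ofReal_re, one_mul, star_neg,
    Complex.star_def, Complex.conj_ofReal] at h
  have := norm_nonneg w
  linarith

/-- The pullback of the forms along a linear map `w`: the compression `a ↦ w* φ(a) w`. -/
def pull {E' : Type*} [AddCommGroup E'] [Module ℂ E'] (s : CPForm 𝒜 E) (w : E' →ₗ[ℂ] E) :
    CPForm 𝒜 E' where
  toFun a x y := s a (w x) (w y)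
  add_alg a b x y := s.add_alg _ _ _ _
  smul_alg c a x y := s.smul_alg _ _ _ _
  add_right a x y z := by rw [map_add, s.add_right]
  smul_right a x c y := by rw [map_smul, s.smul_right]
  conj_symm a x y := s.conj_symm _ _ _
  pos m a x := s.pos m a _

lemma exists_tendsto_of_bounded {I : Type*} (U : Ultrafilter I) {f : I → ℂ} {C : ℝ}
    (h : ∀ i, ‖f i‖ ≤ C) : ∃ l, Tendsto f U (𝓝 l) := by
  obtain ⟨l, -, hl⟩ := (isCompact_closedBall (0 : ℂ) C).ultrafilter_le_nhds' (U.map f)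
    (Filter.mem_map.mpr (Filter.univ_mem' fun i => by simpa using h i))
  exact ⟨l, hl⟩

/-- Pointwise bounded families of completely positive maps have limits along ultrafilters. -/
lemma exists_tendsto {I : Type*} (U : Ultrafilter I) (s : I → CPForm 𝒜 E)
    (h : ∀ a x y, ∃ C : ℝ, ∀ i, ‖s i a x y‖ ≤ C) :
    ∃ t : CPForm 𝒜 E, ∀ a x y, Tendsto (fun i => s i a x y) U (𝓝 (t a x y)) := by
  have h' : ∀ a x y, ∃ l, Tendsto (fun i => s i a x y) U (𝓝 l) := fun a x y =>
    (h a x y).elim fun C hC => exists_tendsto_of_bounded U hC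
  choose t ht using h'
  refine ⟨⟨t, fun a b x y => ?_, fun c a x y => ?_, fun a x y z => ?_, fun a x c y => ?_,
    fun a x y => ?_, fun m a x => ?_⟩, ht⟩
  · refine tendsto_nhds_unique (ht (a + b) x y) ?_
    simpa only [(s _).add_alg] using (ht a x y).add (ht b x y)
  · refine tendsto_nhds_unique (ht (c • a) x y) ?_
    simpa only [(s _).smul_alg] using (ht a x y).const_mul c
  · refine tendsto_nhds_unique (ht a x (y + z)) ?_
    simpa only [(s _).add_right] using (ht a x y).add (ht a x z)
  · refine tendsto_nhds_unique (ht a x (c • y)) ?_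
    simpa only [(s _).smul_right] using (ht a x y).const_mul c
  · refine tendsto_nhds_unique (ht a x y).star ?_
    simpa only [(s _).conj_symm] using ht (star a) y x
  · have h1 := tendsto_finsetSum Finset.univ fun i _ =>
      tendsto_finsetSum Finset.univ fun j _ => ht (star (a i) * a j) (x i) (x j)
    exact ge_of_tendsto' ((Complex.continuous_re.tendsto _).comp h1) fun i => (s i).pos m a x

end CPForm

/-- A finite set of vectors lies in the range of an isometry of some `ℂⁿ` with `n ≥ 1`. -/
lemma exists_isometry_finset {H : Type*} [NormedAddCommGroup H] [InnerProductSpace ℂ H]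
    [Nontrivial H] (t : Finset H) :
    ∃ n, 1 ≤ n ∧ ∃ v : EuclideanSpace ℂ (Fin n) →ₗᵢ[ℂ] H, ∀ x ∈ t, ∃ p, v p = x := by
  obtain ⟨h, hh⟩ := exists_ne (0 : H)
  classical
  -- a nonzero vector is added to ensure that the dimension is positive
  let F := Submodule.span ℂ ((insert h t : Finset H) : Set H)
  have hF : ∀ x ∈ insert h t, x ∈ F := fun x hx => Submodule.subset_span hx
  have : FiniteDimensional ℂ F := FiniteDimensional.span_finset ℂ _
  have : Nontrivial F :=
    ⟨⟨⟨h, hF h (Finset.mem_insert_self _ _)⟩, 0, fun h0 => hh (congrArg Subtype.val h0)⟩⟩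
  refine ⟨Module.finrank ℂ F, Module.finrank_pos, F.subtypeₗᵢ.comp
    (stdOrthonormalBasis ℂ F).repr.symm.toLinearIsometry, fun x hx =>
      ⟨(stdOrthonormalBasis ℂ F).repr ⟨x, hF x (Finset.mem_insert_of_mem hx)⟩, ?_⟩⟩
  simp

/-! ### Dilations from inclusions of matrix ranges -/

section Dilation

variable {d : ℕ} {H K : Type u}
  [NormedAddCommGroup H] [InnerProductSpace ℂ H] [CompleteSpace H]
  [NormedAddCommGroup K] [InnerProductSpace ℂ K] [CompleteSpace K]

/-- The compression of `A` to a finite-dimensional subspace lies in the matrix range of `A`. -/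
lemma exists_mem_W_of_isometry (A : Fin d → (H →L[ℂ] H)) {n : ℕ}
    (v : EuclideanSpace ℂ (Fin n) →ₗᵢ[ℂ] H) :
    ∃ X ∈ W n A, ∀ i p q, inner ℂ p (matRep n (X i) q) = inner ℂ (v p) (A i (v q)) := by
  let s := (CPForm.ofRep (cstarGen A).subtype).pull v.toLinearMap
  refine ⟨fun i => s.toMatrix (gen A i), mem_W_iff.mpr ⟨s, fun p q => ?_, fun i p q => ?_⟩,
    fun i p q => ?_⟩
  · change inner ℂ (v p) (v q) = _
    exact v.inner_map_map p q
  · exact (s.inner_toMatrix _ p q).symm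
  · rw [s.inner_toMatrix]
    rfl

/-- On a given finite set of vectors of `H`, a completely positive map on `C*(B)` that is unital and
maps `c B_i` to `A_i` up to `ε`. -/
lemma exists_cpForm_approx [Nontrivial H] {A : Fin d → (H →L[ℂ] H)} {B : Fin d → (K →L[ℂ] K)}
    {c : ℂ} (h : ∀ n, 1 ≤ n → ∀ X ∈ W n A, X ∈ closure ((fun Y => c • Y) '' W n B))
    (t : Finset H) {ε : ℝ} (hε : 0 < ε) :
    ∃ s : CPForm (cstarGen B) H, (∀ a x y, ‖s a x y‖ ≤ ‖x‖ ^ 2 + ‖a‖ ^ 2 * ‖y‖ ^ 2) ∧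
      (∀ x ∈ t, ∀ y ∈ t, s 1 x y = inner ℂ x y) ∧
      ∀ i, ∀ x ∈ t, ∀ y ∈ t, ‖c * s (gen B i) x y - inner ℂ x (A i y)‖ < ε := by
  obtain ⟨n, hn, v, hv⟩ := exists_isometry_finset t
  obtain ⟨X, hX, hXA⟩ := exists_mem_W_of_isometry A v
  let w : H →L[ℂ] EuclideanSpace ℂ (Fin n) :=
    ContinuousLinearMap.adjoint v.toContinuousLinearMap
  have hwv : ∀ p, w (v p) = p := fun p => by
    refine ext_inner_left ℂ fun q => ?_
    rw [ContinuousLinearMap.adjoint_inner_right]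
    exact v.inner_map_map q p
  have hw : ∀ x, ‖w x‖ ≤ ‖x‖ := fun x => by
    have h1 : ‖w‖ ≤ 1 := by
      rw [LinearIsometryEquiv.norm_map]
      exact v.norm_toContinuousLinearMap_le
    simpa using w.le_of_opNorm_le h1 x
  -- being close to `A` on the finite set of vectors is an open condition that the compression `X`
  -- of `A` satisfies
  have hU : {Y : MatTuple d n | ∀ i, ∀ x ∈ t, ∀ y ∈ t,
      ‖inner ℂ (w x) (matRep n (Y i) (w y)) - inner ℂ x (A i y)‖ < ε} ∈ 𝓝 X := by
    have hev : ∀ i, ∀ x ∈ t, ∀ y ∈ t, ∀ᶠ Y : MatTuple d n in 𝓝 X,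
        ‖inner ℂ (w x) (matRep n (Y i) (w y)) - inner ℂ x (A i y)‖ < ε := by
      intro i x hx y hy
      have hcont : Continuous fun Y : MatTuple d n =>
          ‖inner ℂ (w x) (matRep n (Y i) (w y)) - inner ℂ x (A i y)‖ := by
        simp only [inner_matRep]
        refine (Continuous.sub (continuous_finsetSum _ fun k _ =>
          continuous_finsetSum _ fun l _ => ?_) continuous_const).norm
        have he : Continuous fun Y : MatTuple d n => Y i k l :=
          (continuous_apply_apply k l).comp
            ((CStarMatrix.ofMatrixL (A := ℂ)).symm.continuous.comp (continuous_apply i))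
        exact (continuous_const.mul he).mul continuous_const
      refine hcont.continuousAt.eventually_lt continuousAt_const ?_
      obtain ⟨p, rfl⟩ := hv x hx
      obtain ⟨q, rfl⟩ := hv y hy
      rw [hwv, hwv, hXA, sub_self, norm_zero]
      exact hε
    refine eventually_all.mpr fun i => ?_
    rw [eventually_all_finset]
    intro x hx
    rw [eventually_all_finset]
    exact hev i x hx
  obtain ⟨_, hY, Y, hYB, rfl⟩ := mem_closure_iff_nhds.mp (h n hn X hX) _ hU
  obtain ⟨s, hs1, hs⟩ := mem_W_iff.mp hYB
  refine ⟨s.pull w.toLinearMap, fun a x y => ?_, fun x hx y hy => ?_, fun i x hx y hy => ?_⟩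
  · have h2 : ∀ x, (s 1 (w x) (w x)).re ≤ ‖x‖ ^ 2 := fun x => by
      rw [hs1]
      refine (inner_self_eq_norm_sq (𝕜 := ℂ) (w x)).trans_le ?_
      gcongr
      exact hw x
    refine (s.norm_apply_le a (w x) (w y)).trans ?_
    gcongr
    · exact h2 x
    · exact h2 y
  · obtain ⟨p, rfl⟩ := hv x hx
    obtain ⟨q, rfl⟩ := hv y hy
    change s 1 (w (v p)) (w (v q)) = _
    rw [hwv, hwv, hs1, v.inner_map_map]
  · have h3 := hY i x hx y hy
    beta_reduce at h3
    rwa [Pi.smul_apply, map_smul, smul_apply, inner_smul_right, ← hs] at h3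

/-- If every matrix range `W n A` lies in the closure of `c • W n B`, then `A ≺ cB`. The map
`C*(B) → B(H)` is an ultrafilter limit of maps that are correct on finitely many vectors. -/
theorem dilates_of_forall_mem_closure [Nontrivial H] {A : Fin d → (H →L[ℂ] H)}
    {B : Fin d → (K →L[ℂ] K)} {c : ℝ}
    (h : ∀ n, 1 ≤ n → ∀ X ∈ W n A, X ∈ closure ((fun Y => (c : ℂ) • Y) '' W n B)) :
    Dilates A c B := by
  classical
  choose s hb h1 hg using fun i : Finset H × ℕ =>
    exists_cpForm_approx h i.1 (Nat.one_div_pos_of_nat (α := ℝ) (n := i.2))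
  let U : Ultrafilter (Finset H × ℕ) := Ultrafilter.of atTop
  have hU : (U : Filter (Finset H × ℕ)) ≤ atTop := Ultrafilter.of_le atTop
  obtain ⟨t, ht⟩ := CPForm.exists_tendsto U s fun a x y => ⟨_, fun i => hb i a x y⟩
  have hev : ∀ x y : H, ∀ᶠ i in (U : Filter (Finset H × ℕ)), x ∈ i.1 ∧ y ∈ i.1 := by
    intro x y
    filter_upwards [hU (eventually_ge_atTop (({x, y} : Finset H), 0))] with i hi
    exact ⟨hi.1 (by simp), hi.1 (by simp)⟩
  refine dilates_of_cpForm t (fun x y => ?_) (fun i x y => ?_)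
  · refine tendsto_nhds_unique (ht 1 x y) (tendsto_const_nhds.congr' ?_)
    filter_upwards [hev x y] with i hi
    exact (h1 i x hi.1 y hi.2).symm
  · refine tendsto_nhds_unique ((ht (gen B i) x y).const_mul (c : ℂ)) ?_
    rw [tendsto_iff_norm_sub_tendsto_zero]
    have h0 : Tendsto (fun j : Finset H × ℕ => 1 / ((j.2 : ℝ) + 1)) U (𝓝 0) := by
      refine tendsto_one_div_add_atTop_nhds_zero_nat.comp (Tendsto.mono_left ?_ hU)
      rw [← prod_atTop_atTop_eq]
      exact tendsto_snd
    refine squeeze_zero' (Eventually.of_forall fun _ => norm_nonneg _) ?_ h0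
    filter_upwards [hev x y] with j hj
    exact (hg j i x hj.1 y hj.2).le

end Dilation

/-! ### Semicontinuity -/

section Semicontinuity

variable {d : ℕ}
    {H : ℕ → Type u} [∀ N, NormedAddCommGroup (H N)] [∀ N, InnerProductSpace ℂ (H N)]
    [∀ N, CompleteSpace (H N)]
    {K : ℕ → Type u} [∀ N, NormedAddCommGroup (K N)] [∀ N, InnerProductSpace ℂ (K N)]
    [∀ N, CompleteSpace (K N)]
    {Hlim : Type u} [NormedAddCommGroup Hlim] [InnerProductSpace ℂ Hlim] [CompleteSpace Hlim]
    {Klim : Type u} [NormedAddCommGroup Klim] [InnerProductSpace ℂ Klim] [CompleteSpace Klim]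
    {ξ : ∀ N, Fin d → (H N →L[ℂ] H N)} {η : ∀ N, Fin d → (K N →L[ℂ] K N)}
    {ξlim : Fin d → (Hlim →L[ℂ] Hlim)} {ηlim : Fin d → (Klim →L[ℂ] Klim)}

lemma infEDist_W_le_dmr {A : Fin d → (Hlim →L[ℂ] Hlim)} {B : Fin d → (Klim →L[ℂ] Klim)}
    {n : ℕ} (hn : 1 ≤ n) {X : MatTuple d n} (hX : X ∈ W n A) :
    Metric.infEDist X (W n B) ≤ dmr A B :=
  (le_iSup₂ (f := fun X (_ : X ∈ W n A) => ⨅ Y ∈ W n B, edist X Y) X hX).trans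
    (le_iSup₂ (f := fun n (_ : 1 ≤ n) => ⨆ X ∈ W n A, ⨅ Y ∈ W n B, edist X Y) n hn)

theorem dmr_le_liminf
    (hξ : ∀ n : ℕ, 1 ≤ n → Tendsto
      (fun N => Metric.hausdorffEDist (W n (ξ N)) (W n ξlim)) atTop (𝓝 0))
    (hη : ∀ n : ℕ, 1 ≤ n → Tendsto
      (fun N => Metric.hausdorffEDist (W n (η N)) (W n ηlim)) atTop (𝓝 0)) :
    dmr ξlim ηlim ≤ liminf (fun p : ℕ × ℕ => dmr (ξ p.1) (η p.2)) atTop := by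
  refine le_of_forall_gt_imp_ge_of_dense fun r hr => ?_
  have hfreq := frequently_lt_of_liminf_lt (by isBoundedDefault) hr
  refine iSup₂_le fun n hn => iSup₂_le fun X hX => ?_
  change Metric.infEDist X (W n ηlim) ≤ r
  refine ENNReal.le_of_forall_pos_le_add fun ε hε _ => ?_
  have hε3 : (0 : ℝ≥0∞) < ε / 2 := by
    simpa using hε.ne'
  have h1 : ∀ᶠ p : ℕ × ℕ in atTop, Metric.hausdorffEDist (W n (ξ p.1)) (W n ξlim) < ε / 2 := by
    rw [← prod_atTop_atTop_eq]
    exact tendsto_fst.eventually ((hξ n hn).eventually_lt_const hε3)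
  have h2 : ∀ᶠ p : ℕ × ℕ in atTop, Metric.hausdorffEDist (W n (η p.2)) (W n ηlim) < ε / 2 := by
    rw [← prod_atTop_atTop_eq]
    exact tendsto_snd.eventually ((hη n hn).eventually_lt_const hε3)
  obtain ⟨⟨N, M⟩, hp, hN, hM⟩ := (hfreq.and_eventually (h1.and h2)).exists
  dsimp only at hp hN hM
  rw [Metric.hausdorffEDist_comm] at hN
  obtain ⟨X', hX', hXX'⟩ := Metric.exists_edist_lt_of_hausdorffEDist_lt hX hN
  calc Metric.infEDist X (W n ηlim)
      ≤ Metric.infEDist X (W n (η M)) + Metric.hausdorffEDist (W n (η M)) (W n ηlim) :=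
        Metric.infEDist_le_infEDist_add_hausdorffEDist
    _ ≤ (Metric.infEDist X' (W n (η M)) + edist X X') +
        Metric.hausdorffEDist (W n (η M)) (W n ηlim) := by
        gcongr
        exact Metric.infEDist_le_infEDist_add_edist
    _ ≤ (r + ε / 2) + ε / 2 := by
        gcongr
        exact (infEDist_W_le_dmr hn hX').trans hp.le
    _ = r + ε := by rw [add_assoc, ENNReal.add_halves]

/-- The matrix ranges of `B` are bounded. -/
lemma norm_inner_matRep_le {B : Fin d → (Klim →L[ℂ] Klim)} {n : ℕ} {Y : MatTuple d n}
    (hY : Y ∈ W n B) (i : Fin d) (p q : EuclideanSpace ℂ (Fin n)) :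
    ‖inner ℂ p (matRep n (Y i) q)‖ ≤ ‖p‖ ^ 2 + ‖gen B i‖ ^ 2 * ‖q‖ ^ 2 := by
  obtain ⟨s, hs1, hs⟩ := mem_W_iff.mp hY
  have h : ∀ x, (s 1 x x).re = ‖x‖ ^ 2 := fun x => by
    rw [hs1]
    exact inner_self_eq_norm_sq (𝕜 := ℂ) x
  rw [← hs, ← h, ← h]
  exact s.norm_apply_le _ _ _

lemma eq_zero_of_W_subset_zero {A : Fin d → (Hlim →L[ℂ] Hlim)} [Nontrivial Hlim]
    (h : ∀ n, 1 ≤ n → ∀ X ∈ W n A, X = 0) : A = 0 := by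
  ext i x
  have h0 : ∀ x, inner ℂ (A i x) x = 0 := by
    intro x
    obtain ⟨n, hn, v, hv⟩ := exists_isometry_finset {x}
    obtain ⟨p, rfl⟩ := hv x (by simp)
    obtain ⟨X, hX, hXA⟩ := exists_mem_W_of_isometry A v
    rw [← inner_conj_symm, ← hXA, h n hn X hX]
    simp
  have := (inner_map_self_eq_zero (A i).toLinearMap).mp h0
  exact congrArg (fun f : Hlim →ₗ[ℂ] Hlim => f x) this

/-- The completely positive map `a ↦ ω(a) 1` into `M_n`, where `ω(a) = s a e e`. -/
noncomputable def CPForm.ofScalar {𝒜 E : Type*} [CStarAlgebra 𝒜] [AddCommGroup E] [Module ℂ E]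
    (s : CPForm 𝒜 E) (e : E) (n : ℕ) : CPForm 𝒜 (EuclideanSpace ℂ (Fin n)) where
  toFun a p q := s a e e * inner ℂ p q
  add_alg a b x y := by rw [s.add_alg, add_mul]
  smul_alg c a x y := by rw [s.smul_alg, mul_assoc]
  add_right a x y z := by rw [inner_add_right, mul_add]
  smul_right a x c y := by rw [inner_smul_right]; ring
  conj_symm a x y := by
    rw [star_mul', s.conj_symm]
    congr 1
    exact inner_conj_symm _ _
  pos m a x := by
    -- the sum splits over the coordinates of `ℂⁿ`, where `s` is positive
    have h : ∑ i, ∑ j, s (star (a i) * a j) e e * inner ℂ (x i) (x j) =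
        ∑ k, ∑ i, ∑ j, s (star (a i) * a j) (x i k • e) (x j k • e) := by
      conv_rhs => rw [Finset.sum_comm]
      refine Finset.sum_congr rfl fun i _ => ?_
      conv_rhs => rw [Finset.sum_comm]
      refine Finset.sum_congr rfl fun j _ => ?_
      rw [PiLp.inner_apply, Finset.mul_sum]
      refine Finset.sum_congr rfl fun k _ => ?_
      rw [s.smul_left, s.smul_right, RCLike.inner_apply]
      simp only [Complex.star_def]
      ring
    rw [h, Complex.re_sum]
    exact Finset.sum_nonneg fun k _ => s.pos m a _

lemma zero_mem_W {B : Fin d → (Klim →L[ℂ] Klim)} (h : 0 ∈ W 1 B) (n : ℕ) : 0 ∈ W n B := by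
  obtain ⟨s, hs1, hs⟩ := mem_W_iff.mp h
  refine mem_W_iff.mpr ⟨s.ofScalar (EuclideanSpace.single 0 1) n, fun p q => ?_, fun i p q => ?_⟩
  · change s 1 _ _ * _ = _
    rw [hs1]
    simp
  · change s _ _ _ * _ = _
    rw [hs]
    simp

/-- If `A' ≺ cB'` and the matrix ranges of `A'` and `B'` are close to those of `A` and `B`, then the
points of `W n A` are close to `c • W n B`. -/
lemma exists_W_dist_lt {Hn : Type u} [NormedAddCommGroup Hn] [InnerProductSpace ℂ Hn]
    [CompleteSpace Hn] {Kn : Type u} [NormedAddCommGroup Kn] [InnerProductSpace ℂ Kn]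
    [CompleteSpace Kn] {A' : Fin d → (Hn →L[ℂ] Hn)} {B' : Fin d → (Kn →L[ℂ] Kn)}
    {A : Fin d → (Hlim →L[ℂ] Hlim)} {B : Fin d → (Klim →L[ℂ] Klim)} {c R ε : ℝ}
    (hc : 0 < c) (hcR : c < R) (hε : 0 < ε) (hD : Dilates A' c B') {n : ℕ}
    (hA : Metric.hausdorffEDist (W n A') (W n A) < ENNReal.ofReal (ε / (1 + R)))
    (hB : Metric.hausdorffEDist (W n B') (W n B) < ENNReal.ofReal (ε / (1 + R)))
    {X : MatTuple d n} (hX : X ∈ W n A) : ∃ Y ∈ W n B, dist X ((c : ℂ) • Y) < ε := by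
  rw [Metric.hausdorffEDist_comm] at hA
  obtain ⟨X', hX', hXX'⟩ := Metric.exists_edist_lt_of_hausdorffEDist_lt hX hA
  obtain ⟨Y', hY', rfl⟩ := hD.exists_smul_eq hc hX'
  obtain ⟨Y, hY, hYY'⟩ := Metric.exists_edist_lt_of_hausdorffEDist_lt hY' hB
  have hR : 0 < 1 + R := by linarith
  have hpos : 0 < ε / (1 + R) := by positivity
  rw [edist_lt_ofReal] at hXX' hYY'
  refine ⟨Y, hY, ?_⟩
  calc dist X ((c : ℂ) • Y) ≤ dist X ((c : ℂ) • Y') + dist ((c : ℂ) • Y') ((c : ℂ) • Y) :=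
        dist_triangle _ _ _
    _ = dist X ((c : ℂ) • Y') + c * dist Y' Y := by
        rw [dist_eq_norm ((c : ℂ) • Y' : MatTuple d n), ← smul_sub, norm_smul,
          Complex.norm_real, Real.norm_of_nonneg hc.le, dist_eq_norm Y']
    _ < ε / (1 + R) + R * (ε / (1 + R)) := by
        refine add_lt_add_of_lt_of_le hXX' ?_
        exact mul_le_mul hcR.le hYY'.le dist_nonneg (by linarith)
    _ = ε := by field_simp

theorem dilationConst_le_liminf [Nontrivial Hlim]
    (hξ : ∀ n : ℕ, 1 ≤ n → Tendsto
      (fun N => Metric.hausdorffEDist (W n (ξ N)) (W n ξlim)) atTop (𝓝 0))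
    (hη : ∀ n : ℕ, 1 ≤ n → Tendsto
      (fun N => Metric.hausdorffEDist (W n (η N)) (W n ηlim)) atTop (𝓝 0))
    (h0 : ξlim ≠ 0 ∨ 0 ∈ W 1 ηlim) :
    dilationConst ξlim ηlim ≤
      liminf (fun p : ℕ × ℕ => dilationConst (ξ p.1) (η p.2)) atTop := by
  refine le_of_forall_gt_imp_ge_of_dense fun r hr => ?_
  rcases eq_or_ne r ⊤ with rfl | hrtop
  · exact le_top
  have hfreq := frequently_lt_of_liminf_lt (by isBoundedDefault) hr
  set R := r.toReal with hR
  have hrR : ENNReal.ofReal R = r := ENNReal.ofReal_toReal hrtop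
  have hseq : ∀ k : ℕ, ∃ N M : ℕ, k ≤ N ∧ k ≤ M ∧ ∃ c : ℝ, 0 < c ∧ c < R ∧
      Dilates (ξ N) c (η M) := by
    intro k
    obtain ⟨⟨N, M⟩, ⟨hN, hM⟩, hp⟩ := frequently_atTop.mp hfreq (k, k)
    simp only [dilationConst, iInf_lt_iff] at hp
    obtain ⟨c, hc, hD, hcr⟩ := hp
    refine ⟨N, M, hN, hM, c, hc, ?_, hD⟩
    rw [← hrR] at hcr
    exact (ENNReal.ofReal_lt_ofReal_iff_of_nonneg hc.le).mp hcr
  choose N M hN hM c hc hcR hD using hseq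
  have hle : ∀ {c : ℝ}, 0 < c → c ≤ R → Dilates ξlim c ηlim → dilationConst ξlim ηlim ≤ r := by
    intro c hc hcR hD
    rw [← hrR]
    exact (iInf_le_of_le c (iInf_le_of_le hc (iInf_le_of_le hD le_rfl))).trans
      (ENNReal.ofReal_le_ofReal hcR)
  have hR0 : 0 < R := (hc 0).trans (hcR 0)
  obtain ⟨c₀, ⟨hc₀, hc₀R⟩, φ, hφ, hlim⟩ :=
    (isCompact_Icc (a := (0 : ℝ)) (b := R)).tendsto_subseq fun k => ⟨(hc k).le, (hcR k).le⟩
  have hNtop : Tendsto (N ∘ φ) atTop atTop :=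
    (tendsto_atTop_mono hN tendsto_id).comp hφ.tendsto_atTop
  have hMtop : Tendsto (M ∘ φ) atTop atTop :=
    (tendsto_atTop_mono hM tendsto_id).comp hφ.tendsto_atTop
  have happrox : ∀ n, 1 ≤ n → ∀ X ∈ W n ξlim, ∀ ε > 0, ∀ᶠ k in atTop,
      ∃ Y ∈ W n ηlim, dist X ((c (φ k) : ℂ) • Y) < ε := by
    intro n hn X hX ε hε
    have hpos : 0 < ENNReal.ofReal (ε / (1 + R)) := by
      rw [ENNReal.ofReal_pos]; positivity
    filter_upwards [((hξ n hn).comp hNtop).eventually_lt_const hpos,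
      ((hη n hn).comp hMtop).eventually_lt_const hpos] with k h1 h2
    exact exists_W_dist_lt (hc _) (hcR _) hε (hD _) h1 h2 hX
  -- for `c₀ = 0` the points `c_k Y` tend to `0`, because `W n ηlim` is bounded
  rcases hc₀.eq_or_lt with hc₀ | hc₀
  · have hzero : ∀ n, 1 ≤ n → ∀ X ∈ W n ξlim, X = 0 := by
      intro n hn X hX
      ext1 i
      refine CStarMatrix.ext fun k l => ?_
      refine norm_eq_zero.mp (le_antisymm (le_of_forall_pos_le_add fun δ hδ => ?_) (norm_nonneg _))
      set C := 1 + ‖gen ηlim i‖ ^ 2 with hC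
      have hsmall : ∀ᶠ j in atTop, c (φ j) * C < δ / 2 := by
        have : Tendsto (fun j => c (φ j) * C) atTop (𝓝 0) := by
          simpa [← hc₀] using hlim.mul_const C
        exact this.eventually_lt_const (by positivity)
      obtain ⟨j, ⟨Y, hY, hXY⟩, hj⟩ :=
        ((happrox n hn X hX (δ / 2) (by positivity)).and hsmall).exists
      have h1 : ‖Y i k l‖ ≤ C := by
        rw [← inner_matRep_single (Y i) k l]
        simpa [hC] using norm_inner_matRep_le hY i (EuclideanSpace.single k 1)
          (EuclideanSpace.single l 1)
      have h2 : ‖X i k l - (c (φ j) : ℂ) * Y i k l‖ ≤ δ / 2 := by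
        rw [dist_eq_norm] at hXY
        exact (CStarMatrix.norm_entry_le_norm (M := (X - (c (φ j) : ℂ) • Y) i)).trans
          ((norm_le_pi_norm _ i).trans hXY.le)
      have h3 : ‖(c (φ j) : ℂ) * Y i k l‖ ≤ δ / 2 := by
        rw [norm_mul, Complex.norm_real, Real.norm_of_nonneg (hc _).le]
        exact (mul_le_mul_of_nonneg_left h1 (hc _).le).trans hj.le
      calc ‖X i k l‖ = ‖(X i k l - (c (φ j) : ℂ) * Y i k l) + (c (φ j) : ℂ) * Y i k l‖ := by
            rw [sub_add_cancel]
        _ ≤ δ / 2 + δ / 2 := norm_add_le_of_le h2 h3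
        _ = 0 + δ := by ring
    rcases h0 with h0 | h0
    · exact absurd (eq_zero_of_W_subset_zero hzero) h0
    · refine hle hR0 le_rfl (dilates_of_forall_mem_closure fun n hn X hX => ?_)
      rw [hzero n hn X hX]
      exact subset_closure ⟨0, zero_mem_W h0 n, smul_zero _⟩
  · refine hle hc₀ hc₀R (dilates_of_forall_mem_closure fun n hn X hX => ?_)
    refine Metric.mem_closure_iff.mpr fun ε hε => ?_
    have hratio : Tendsto (fun k => c₀ / c (φ k)) atTop (𝓝 1) := by
      rw [← div_self hc₀.ne']
      exact tendsto_const_nhds.div hlim hc₀.ne'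
    have h1 : ∀ᶠ k in atTop, c₀ / c (φ k) < 2 := hratio.eventually_lt_const one_lt_two
    have h2 : ∀ᶠ k in atTop, ‖1 - c₀ / c (φ k)‖ * ‖X‖ < ε / 2 := by
      have : Tendsto (fun k => ‖1 - c₀ / c (φ k)‖ * ‖X‖) atTop (𝓝 0) := by
        simpa using ((tendsto_const_nhds (x := (1 : ℝ))).sub hratio).norm.mul_const ‖X‖
      exact this.eventually_lt_const (by positivity)
    obtain ⟨k, ⟨Y, hY, hXY⟩, h1, h2⟩ :=
      ((happrox n hn X hX (ε / 4) (by positivity)).and (h1.and h2)).exists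
    refine ⟨_, ⟨Y, hY, rfl⟩, ?_⟩
    set b := c (φ k) with hb
    have hb0 : 0 < b := hc _
    -- `c₀ Y` is compared with `X` through `(c₀ / b) X`, since `Y` itself carries no bound here
    have hsplit : X - (c₀ : ℂ) • Y =
        ((1 - c₀ / b : ℝ) : ℂ) • X + ((c₀ / b : ℝ) : ℂ) • (X - (b : ℂ) • Y) := by
      have hbc : (b : ℂ) ≠ 0 := by exact_mod_cast hb0.ne'
      rw [smul_sub, smul_smul, ← add_sub_assoc, ← add_smul]
      push_cast
      rw [sub_add_cancel, one_smul, div_mul_cancel₀ _ hbc]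
    rw [dist_eq_norm] at hXY
    change dist X ((c₀ : ℂ) • Y) < ε
    rw [dist_eq_norm, hsplit]
    calc _ ≤ ‖1 - c₀ / b‖ * ‖X‖ + (c₀ / b) * ‖X - (b : ℂ) • Y‖ := by
          refine (norm_add_le _ _).trans ?_
          rw [norm_smul, norm_smul, Complex.norm_real, Complex.norm_real,
            Real.norm_of_nonneg (div_pos hc₀ hb0).le]
      _ < ε / 2 + 2 * (ε / 4) := by
          refine add_lt_add_of_lt_of_le h2 ?_
          exact mul_le_mul h1.le hXY.le (norm_nonneg _) (by norm_num)
      _ = ε := by ring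

end Semicontinuity

end MatrixRange

theorem theorem2p1 (d : ℕ)
    (H : ℕ → Type u) [∀ N, NormedAddCommGroup (H N)] [∀ N, InnerProductSpace ℂ (H N)]
    [∀ N, CompleteSpace (H N)] [∀ N, Nontrivial (H N)]
    (K : ℕ → Type u) [∀ N, NormedAddCommGroup (K N)] [∀ N, InnerProductSpace ℂ (K N)]
    [∀ N, CompleteSpace (K N)] [∀ N, Nontrivial (K N)]
    (Hlim : Type u) [NormedAddCommGroup Hlim] [InnerProductSpace ℂ Hlim]
    [CompleteSpace Hlim] [Nontrivial Hlim]
    (Klim : Type u) [NormedAddCommGroup Klim] [InnerProductSpace ℂ Klim]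
    [CompleteSpace Klim] [Nontrivial Klim]
    (ξ : ∀ N, Fin d → (H N →L[ℂ] H N)) (η : ∀ N, Fin d → (K N →L[ℂ] K N))
    (ξlim : Fin d → (Hlim →L[ℂ] Hlim)) (ηlim : Fin d → (Klim →L[ℂ] Klim))
    (hξ : ∀ n : ℕ, 1 ≤ n → Tendsto
      (fun N => Metric.hausdorffEDist (MatrixRange.W n (ξ N)) (MatrixRange.W n ξlim)) atTop (𝓝 0))
    (hη : ∀ n : ℕ, 1 ≤ n → Tendsto
      (fun N => Metric.hausdorffEDist (MatrixRange.W n (η N)) (MatrixRange.W n ηlim)) atTop (𝓝 0)) :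
    MatrixRange.dmr ξlim ηlim ≤
        liminf (fun p : ℕ × ℕ => MatrixRange.dmr (ξ p.1) (η p.2)) atTop ∧
      ((ξlim ≠ 0 ∨ 0 ∈ MatrixRange.W 1 ηlim) →
        MatrixRange.dilationConst ξlim ηlim ≤
          liminf (fun p : ℕ × ℕ => MatrixRange.dilationConst (ξ p.1) (η p.2)) atTop) := by
  exact ⟨MatrixRange.dmr_le_liminf hξ hη, fun h => MatrixRange.dilationConst_le_liminf hξ hη h⟩
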